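/- Let $n\ge 2$ be an integer, let $\mathbb S^{n-1}$ be the unit sphere of $\mathbb R^n$ with surface measure $du$, and let $|\cdot|$ denote Lebesgue measure on $\mathbb R^n$. A convex body is a compact convex set with non-empty interior, and its support function is $h_K(u)=\sup_{x\in K}\langle x,u\rangle$, $u\in\mathbb S^{n-1}$. For $\psi\in C^2(\mathbb S^{n-1})$ let $\psi_i(u)$ and $\psi_{ij}(u)$, $1\le i,j\le n-1$, be the first and second covariant derivatives of $\psi$ with respect to an orthonormal frame on $\mathbb S^{n-1}$; write $\nabla\psi=(\psi_1,\dots,\psi_{n-1})$ and $Q(\psi)=Q(\psi;u)=(\psi_{ij}(u)+\psi(u)\delta_{ij})_{i,j}$. Let $C^{2,+}_e(\mathbb S^{n-1})$ be the set of even functions $h\in C^2(\mathbb S^{n-1})$ with $Q(h;u)$ positive definite for every $u\in\mathbb S^{n-1}$. For $h\in C^{2,+}_e(\mathbb S^{n-1})$ put $K=\{x\in\mathbb R^n:\langle x,u\rangle\le h(u)\ \ \forall u\in\mathbb S^{n-1}\}$ and $$d\bar V_h=\frac1{|K|}\,\frac1n\,h(u)\det Q(h;u)\,du .$$ The log-Brunn–Minkowski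 conjecture in $\mathbb R^n$ states that for all symmetric convex bodies $A,B\subset\mathbb R^n$ (that is, $A=-A$ and $B=-B$) and every $\lambda\in[0,1]$, $$\left|\{x\in\mathbb R^n:\langle x,u\rangle\le h_A(u)^{\lambda}h_B(u)^{1-\lambda}\ \ \forall u\in\mathbb S^{n-1}\}\right|\ \ge\ |A|^{\lambda}|B|^{1-\lambda}.$$ **Theorem (infinitesimal form of the log-Brunn–Minkowski conjecture).** For every $h\in C^{2,+}_e(\mathbb S^{n-1})$ the set $K$ is a convex body with support function $h$ (so that $\bar V_h$ is its normalized cone measure). If the log-Brunn–Minkowski conjecture in $\mathbb R^n$ holds, then for every $h\in C^{2,+}_e(\mathbb S^{n-1})$ and every even, strictly positive $\psi\in C^2(\mathbb S^{n-1})$, $$\int_{\mathbb S^{n-1}}\psi^2\,\frac{1+\operatorname{tr}(Q^{-1}(h))\,h}{h^2}\,d\bar V_h-n\left(\int_{\mathbb S^{n-1}}\frac{\psi}{h}\,d\bar V_h\right)^2\le\int_{\mathbb S^{n-1}}\frac1h\,\langle Q^{-1}(h)\nabla\psi,\nabla\psi\rangle\,d\bar V_h .$$ For such $h$ and $\psi$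 this strengthens Colesanti's infinitesimal Brunn–Minkowski inequality $$\int_{\mathbb S^{n-1}}\psi^2\,\frac{\operatorname{tr}(Q^{-1}(h))}{h}\,d\bar V_h-(n-1)\left(\int_{\mathbb S^{n-1}}\frac{\psi}{h}\,d\bar V_h\right)^2\le\int_{\mathbb S^{n-1}}\frac1h\,\langle Q^{-1}(h)\nabla\psi,\nabla\psi\rangle\,d\bar V_h ,$$ in the sense that (whether or not the conjecture holds) the left-hand side of the latter inequality is at most the left-hand side of the former, while the right-hand sides coincide. -/

import Mathlib

open MeasureTheory Set Metric Module
open scoped Manifold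

noncomputable section

/-- The `n`-dimensional Euclidean space. -/
abbrev Euc (n : ℕ) : Type := EuclideanSpace ℝ (Fin n)

/-- The unit sphere of the `n`-dimensional Euclidean space. -/
abbrev USphere (n : ℕ) : Type := sphere (0 : Euc n) 1

/-- The dimension count that Mathlib's manifold structure on the sphere asks for. -/
instance factFinrankEuc (n : ℕ) [NeZero n] : Fact (finrank ℝ (Euc n) = (n - 1) + 1) :=
  ⟨by rw [finrank_euclideanSpace_fin, Nat.sub_add_cancel (NeZero.one_le)]⟩

/-! ### Convex bodies -/

/-- A convex body: a compact convex set with non-empty interior. -/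
structure IsConvexBody {n : ℕ} (K : Set (Euc n)) : Prop where
  convex : Convex ℝ K
  isCompact : IsCompact K
  interior_nonempty : (interior K).Nonempty

/-- A set is symmetric if it contains `-x` whenever it contains `x`. -/
def IsSymmetricSet {n : ℕ} (K : Set (Euc n)) : Prop := ∀ x ∈ K, -x ∈ K

/-- The support function `h_K(u) = sup_{x ∈ K} ⟨x, u⟩` on the unit sphere. -/
def supportFn {n : ℕ} (K : Set (Euc n)) (u : USphere n) : ℝ :=
  sSup ((fun x : Euc n => inner ℝ x (u : Euc n)) '' K)

/-- The set `{x : ⟨x, u⟩ ≤ h(u) for all unit vectors u}`. If `h` is the support function of a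
convex body `K`, this set is `K`. -/
def bodyOf {n : ℕ} (h : USphere n → ℝ) : Set (Euc n) :=
  {x | ∀ u : USphere n, inner ℝ x (u : Euc n) ≤ h u}

/-- The geometric average `K^t L^(1-t)` of two convex bodies. -/
def geomAverage {n : ℕ} (K L : Set (Euc n)) (t : ℝ) : Set (Euc n) :=
  bodyOf fun u => supportFn K u ^ t * supportFn L u ^ (1 - t)

/-- The log-Brunn-Minkowski conjecture in dimension `n`. -/
def LogBrunnMinkowski (n : ℕ) : Prop :=
  ∀ K L : Set (Euc n), IsConvexBody K → IsSymmetricSet K → IsConvexBody L → IsSymmetricSet L →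
    ∀ t ∈ Icc (0 : ℝ) 1,
      volume K ^ t * volume L ^ (1 - t) ≤ volume (geomAverage K L t)

/-! ### Calculus on the sphere -/

/-- The class `C²` of functions on the unit sphere. -/
def IsC2 {n : ℕ} [NeZero n] (ψ : USphere n → ℝ) : Prop :=
  ContMDiff (𝓡 (n - 1)) 𝓘(ℝ, ℝ) 2 ψ

/-- Even functions on the sphere. -/
def IsEvenFn {n : ℕ} (ψ : USphere n → ℝ) : Prop := ∀ u, ψ (-u) = ψ u

/-- An orthonormal frame: an orthonormal basis of the tangent space `u^⊥` at every point `u`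
of the sphere. -/
abbrev SphereFrame (n : ℕ) : Type :=
  ∀ u : USphere n, OrthonormalBasis (Fin (n - 1)) ℝ ((ℝ ∙ (u : Euc n))ᗮ : Submodule ℝ (Euc n))

/-- The extension `x ↦ ψ(x / |x|)` of a function on the sphere, constant along rays
(with value `0` at the origin). -/
def radialExt {n : ℕ} (ψ : USphere n → ℝ) (x : Euc n) : ℝ :=
  if hx : x = 0 then 0 else
    ψ ⟨‖x‖⁻¹ • x, by
      rw [mem_sphere_zero_iff_norm, norm_smul, norm_inv, norm_norm,
        inv_mul_cancel₀ (norm_ne_zero_iff.mpr hx)]⟩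

/-- The spherical gradient `(ψ_1, …, ψ_{n-1})` at `u`: the first covariant derivatives of `ψ`
with respect to the frame. -/
def sphGrad {n : ℕ} (e : SphereFrame n) (ψ : USphere n → ℝ) (u : USphere n) :
    Fin (n - 1) → ℝ :=
  fun i => fderiv ℝ (radialExt ψ) (u : Euc n) (e u i : Euc n)

/-- The matrix `(ψ_{ij}(u))` of second covariant derivatives of `ψ` with respect to the frame.
The Euclidean gradient of `radialExt ψ` restricts on the sphere to the tangential gradient
field of `ψ`, and the covariant derivative of a tangent field `Y` of the sphere in a tangent
direction `v` is the tangential part of `D_v Y`; so `ψ_{ij}(u) = D²(radialExt ψ)(u)[e_i, e_j]`. -/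
def sphHess {n : ℕ} (e : SphereFrame n) (ψ : USphere n → ℝ) (u : USphere n) :
    Matrix (Fin (n - 1)) (Fin (n - 1)) ℝ :=
  Matrix.of fun i j =>
    fderiv ℝ (fderiv ℝ (radialExt ψ)) (u : Euc n) (e u i : Euc n) (e u j : Euc n)

/-- The curvature matrix `Q(ψ; u) = (ψ_{ij}(u) + ψ(u) δ_{ij})`. -/
def curvMatrix {n : ℕ} (e : SphereFrame n) (ψ : USphere n → ℝ) (u : USphere n) :
    Matrix (Fin (n - 1)) (Fin (n - 1)) ℝ :=
  sphHess e ψ u + ψ u • (1 : Matrix (Fin (n - 1)) (Fin (n - 1)) ℝ)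

/-- The class `C^{2,+}_e`: even `C²` functions whose curvature matrix is positive definite
everywhere. -/
structure IsC2PlusEven {n : ℕ} [NeZero n] (e : SphereFrame n) (h : USphere n → ℝ) : Prop where
  isC2 : IsC2 h
  curvMatrix_posDef : ∀ u, (curvMatrix e h u).PosDef
  even : IsEvenFn h

/-- The normalized cone measure
`dV̄_h = (1 / |K|) (1 / n) h(u) det Q(h; u) du` of the convex body `K` with support function `h`;
here `du` is the surface measure of the sphere. -/
def coneMeasure {n : ℕ} (e : SphereFrame n) (h : USphere n → ℝ) : Measure (USphere n) :=
  ((volume : Measure (Euc n)).toSphere).withDensity fun u =>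
    ENNReal.ofReal
      (1 / volume.real (bodyOf h) * (1 / n) * h u * (curvMatrix e h u).det)

end

/-! Extend `h` to `ℝⁿ` as a function homogeneous of degree one. Its Hessian kills the radial
direction and acts on `u^⊥` as `Q(h; u)`, so positive curvature makes the extension strictly convex
across rays. Its gradient at `u` is then the point of `K` with outer normal `u`, and `h` is the
support function of `K` (`HasPosCurv.supportFn_bodyOf`).

For `g > 0` the map `r u ↦ ∇(f + r g)(u)` sweeps the shell between the bodies of `f` and `f + s g`
bijectively, and in polar coordinates its Jacobian is `g det Q(f + r g)`. Hence the derivative of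
the volume `V` at `f` in the direction `g` is `∫ g det Q(f)` (`hasDerivAt_bodyVol`). Let `D(h; ψ)`
(`mixDet`) be the derivative of `det Q` at `h` in the direction `ψ`. Then `∫ ψ D(h; χ)` is a mixed
second derivative of the volume, hence symmetric in `ψ` and `χ` (`integral_mul_mixDet_comm`); this
takes the place of the divergence theorem. Together with `Q(ψ²) = 2ψ Q(ψ) + 2 ∇ψ ⊗ ∇ψ - ψ² I` it
yields `∫ det Q(h) ⟨Q⁻¹(h)∇ψ, ∇ψ⟩ = ∫ ψ² D(h; 1) - ∫ ψ D(h; ψ)` (`integral_dirichlet`).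

Now apply the conjecture with exponent `1/2` to `h + sψ` and `h - sψ`. Their geometric mean `√(h² -
s²ψ²)` need not be a support function, but it is at most `h - s²ψ²/(2h)`, which is one for small
`s`. By monotonicity `V(h + sψ) V(h - sψ) ≤ V(h - s²ψ²/(2h))²`, with equality at `s = 0`. The second
derivative at `0` gives `V(h) (∫ (ψ²/h) det Q + ∫ ψ D(h; ψ)) ≤ (∫ ψ det Q)²`
(`LogBrunnMinkowski.second_variation`). Dividing by `n V(h)²` and inserting the identity above gives
the claim. The comparison with Colesanti's inequality is Cauchy–Schwarz for the cone measure, which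
has total mass one. -/

noncomputable section

/-! ### Homogeneous extensions from the sphere -/

open Filter Topology

variable {n : ℕ}

/-- The unit vector in the direction of a nonzero vector. -/
def unitDir (x : Euc n) (hx : x ≠ 0) : USphere n :=
  ⟨‖x‖⁻¹ • x, by
    rw [mem_sphere_zero_iff_norm, norm_smul, norm_inv, norm_norm,
      inv_mul_cancel₀ (norm_ne_zero_iff.mpr hx)]⟩

lemma radialExt_of_ne_zero (ψ : USphere n → ℝ) {x : Euc n} (hx : x ≠ 0) :
    radialExt ψ x = ψ (unitDir x hx) := by
  rw [radialExt, dif_neg hx]; rfl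

lemma USphere.norm_coe (u : USphere n) : ‖(u : Euc n)‖ = 1 := norm_eq_of_mem_sphere u

lemma USphere.coe_ne_zero (u : USphere n) : (u : Euc n) ≠ 0 := ne_zero_of_mem_unit_sphere u

lemma unitDir_smul {r : ℝ} (hr : 0 < r) (x : Euc n) (hx : x ≠ 0) :
    unitDir (r • x) (smul_ne_zero hr.ne' hx) = unitDir x hx := by
  apply Subtype.ext
  simp only [unitDir, norm_smul, Real.norm_of_nonneg hr.le, smul_smul]
  congr 1
  field_simp

lemma unitDir_coe (u : USphere n) : unitDir (u : Euc n) u.coe_ne_zero = u :=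
  Subtype.ext (by simp [unitDir, u.norm_coe])

lemma norm_smul_unitDir (x : Euc n) (hx : x ≠ 0) : ‖x‖ • (unitDir x hx : Euc n) = x := by
  simp only [unitDir, smul_smul]
  rw [mul_inv_cancel₀ (norm_ne_zero_iff.mpr hx), one_smul]

/-- On the punctured space, an open submanifold, the extension is `ψ` composed with the smooth map
`x ↦ x / |x|` into the sphere. This turns manifold regularity into Euclidean regularity, and only
Euclidean calculus is used afterwards. -/
lemma IsC2.contDiffAt_radialExt [NeZero n] {ψ : USphere n → ℝ} (hψ : IsC2 ψ) {x : Euc n}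
    (hx : x ≠ 0) : ContDiffAt ℝ 2 (radialExt ψ) x := by
  let U : TopologicalSpace.Opens (Euc n) := ⟨{0}ᶜ, isOpen_compl_singleton⟩
  have hcoe : ContMDiff 𝓘(ℝ, Euc n) 𝓘(ℝ, Euc n) 2 (fun y : U => (y : Euc n)) :=
    contMDiff_subtype_val
  have hN : ContMDiff 𝓘(ℝ, Euc n) 𝓘(ℝ, Euc n) 2
      (fun y : U => ‖(y : Euc n)‖⁻¹ • (y : Euc n)) := by
    intro y
    have hy : (y : Euc n) ≠ 0 := y.2
    have h1 : ContDiffAt ℝ 2 (fun z : Euc n => ‖z‖⁻¹ • z) (y : Euc n) :=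
      ((contDiffAt_norm ℝ hy).inv (norm_ne_zero_iff.mpr hy)).smul contDiffAt_id
    exact h1.contMDiffAt.comp y hcoe.contMDiffAt
  have hν : ContMDiff 𝓘(ℝ, Euc n) (𝓡 (n - 1)) 2 (fun y : U => unitDir (y : Euc n) y.2) :=
    hN.codRestrict_sphere _
  have h2 : ContMDiff 𝓘(ℝ, Euc n) 𝓘(ℝ, ℝ) 2 (fun y : U => radialExt ψ (y : Euc n)) := by
    have h3 := ContMDiff.comp (f := fun y : U => unitDir (y : Euc n) y.2) hψ hν
    convert h3 using 1
    funext y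
    exact radialExt_of_ne_zero ψ y.2
  have h4 := h2 ⟨x, hx⟩
  rw [contMDiffAt_subtype_iff] at h4
  exact h4.contDiffAt

/-- The extension of a function on the sphere that is homogeneous of degree one. -/
def homExt (ψ : USphere n → ℝ) (x : Euc n) : ℝ := ‖x‖ * radialExt ψ x

lemma homExt_of_ne_zero (ψ : USphere n → ℝ) {x : Euc n} (hx : x ≠ 0) :
    homExt ψ x = ‖x‖ * ψ (unitDir x hx) := by
  rw [homExt, radialExt_of_ne_zero]

lemma homExt_coe (ψ : USphere n → ℝ) (u : USphere n) : homExt ψ u = ψ u := by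
  rw [homExt_of_ne_zero ψ u.coe_ne_zero, unitDir_coe, u.norm_coe, one_mul]

lemma homExt_smul (ψ : USphere n → ℝ) {r : ℝ} (hr : 0 < r) (x : Euc n) :
    homExt ψ (r • x) = r * homExt ψ x := by
  by_cases hx : x = 0
  · simp [hx, homExt]
  · rw [homExt_of_ne_zero ψ (smul_ne_zero hr.ne' hx), homExt_of_ne_zero ψ hx, unitDir_smul hr,
      norm_smul, Real.norm_of_nonneg hr.le, mul_assoc]

lemma homExt_add_smul (f g : USphere n → ℝ) (t : ℝ) :
    homExt (f + t • g) = homExt f + t • homExt g := by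
  funext x
  by_cases hx : x = 0
  · simp [hx, homExt]
  · simp only [homExt_of_ne_zero _ hx, Pi.add_apply, Pi.smul_apply, smul_eq_mul]
    ring

lemma IsC2.contDiffAt_homExt [NeZero n] {ψ : USphere n → ℝ} (hψ : IsC2 ψ) {x : Euc n}
    (hx : x ≠ 0) : ContDiffAt ℝ 2 (homExt ψ) x :=
  (contDiffAt_norm ℝ hx).mul (hψ.contDiffAt_radialExt hx)

/-- The gradient of the one-homogeneous extension. -/
def homGrad (ψ : USphere n → ℝ) (x : Euc n) : Euc n := gradient (homExt ψ) x

/-- The Hessian, as an operator, of the one-homogeneous extension. -/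
def homHess (ψ : USphere n → ℝ) (x : Euc n) : Euc n →L[ℝ] Euc n := fderiv ℝ (homGrad ψ) x

variable [NeZero n] {f g ψ : USphere n → ℝ} {x : Euc n}

lemma IsC2.contDiffAt_homGrad (hψ : IsC2 ψ) (hx : x ≠ 0) : ContDiffAt ℝ 1 (homGrad ψ) x := by
  have h : ContDiffAt ℝ 1 (fderiv ℝ (homExt ψ)) x :=
    (hψ.contDiffAt_homExt hx).fderiv_right (by norm_num)
  exact ((InnerProductSpace.toDual ℝ (Euc n)).symm.toContinuousLinearEquiv.contDiff.contDiffAt).comp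
    x h

lemma IsC2.hasFDerivAt_homExt (hψ : IsC2 ψ) (hx : x ≠ 0) :
    HasFDerivAt (homExt ψ) (innerSL ℝ (homGrad ψ x)) x :=
  ((hψ.contDiffAt_homExt hx).differentiableAt (by norm_num)).hasGradientAt.hasFDerivAt

lemma IsC2.hasFDerivAt_homGrad (hψ : IsC2 ψ) (hx : x ≠ 0) :
    HasFDerivAt (homGrad ψ) (homHess ψ x) x :=
  ((hψ.contDiffAt_homGrad hx).differentiableAt (by norm_num)).hasFDerivAt

lemma IsC2.continuousAt_homHess (hψ : IsC2 ψ) (hx : x ≠ 0) : ContinuousAt (homHess ψ) x :=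
  ((hψ.contDiffAt_homGrad hx).fderiv_right (m := 0) (by norm_num)).continuousAt

lemma homGrad_smul (ψ : USphere n → ℝ) {r : ℝ} (hr : 0 < r) (hψ : IsC2 ψ) (hx : x ≠ 0) :
    homGrad ψ (r • x) = homGrad ψ x := by
  have h1 := hψ.hasFDerivAt_homExt (smul_ne_zero hr.ne' hx)
  have h2 : HasFDerivAt (fun y : Euc n => r • y) (r • ContinuousLinearMap.id ℝ (Euc n)) x :=
    (hasFDerivAt_id x).const_smul r
  have h3 := h1.comp x h2
  have h4 : homExt ψ ∘ (fun y : Euc n => r • y) = fun y => r • homExt ψ y := by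
    funext y; exact homExt_smul ψ hr y
  rw [h4] at h3
  have h5 := h3.unique ((hψ.hasFDerivAt_homExt hx).const_smul r)
  refine ext_inner_right ℝ fun v => ?_
  have h6 := congrArg (fun L => L v) h5
  simpa [inner_smul_right, hr.ne'] using h6

lemma homHess_smul (ψ : USphere n → ℝ) {r : ℝ} (hr : 0 < r) (hψ : IsC2 ψ) (hx : x ≠ 0) :
    homHess ψ (r • x) = r⁻¹ • homHess ψ x := by
  have h1 := hψ.hasFDerivAt_homGrad (smul_ne_zero hr.ne' hx)
  have h2 : HasFDerivAt (fun y : Euc n => r • y) (r • ContinuousLinearMap.id ℝ (Euc n)) x :=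
    (hasFDerivAt_id x).const_smul r
  have h3 := h1.comp x h2
  have h4 : homGrad ψ ∘ (fun y : Euc n => r • y) =ᶠ[𝓝 x] homGrad ψ := by
    filter_upwards [isOpen_ne.mem_nhds hx] with y hy
    exact homGrad_smul ψ hr hψ hy
  have h5 := (h3.congr_of_eventuallyEq h4.symm).unique (hψ.hasFDerivAt_homGrad hx)
  rw [← h5]
  ext v
  simp [hr.ne']

/-- Euler's identity for the one-homogeneous extension. -/
lemma inner_homGrad_self (hψ : IsC2 ψ) (hx : x ≠ 0) :
    inner ℝ (homGrad ψ x) x = homExt ψ x := by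
  have h1 : HasDerivAt (fun t : ℝ => t • x) x 1 := by
    simpa using (hasDerivAt_id (1 : ℝ)).smul_const x
  have hx' : (1 : ℝ) • x ≠ 0 := by simpa using hx
  have h2 := (hψ.hasFDerivAt_homExt hx').comp_hasDerivAt (1 : ℝ) h1
  have h3 : (homExt ψ ∘ fun t : ℝ => t • x) =ᶠ[𝓝 1] fun t => t * homExt ψ x := by
    filter_upwards [isOpen_Ioi.mem_nhds (show (1 : ℝ) ∈ Ioi 0 by simp)] with t ht
    exact homExt_smul ψ ht x
  have h4 := (h2.congr_of_eventuallyEq h3.symm).unique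
    ((hasDerivAt_id (1 : ℝ)).mul_const (homExt ψ x))
  simpa using h4

/-- Euler's identity for the gradient of the one-homogeneous extension. -/
lemma homHess_apply_self (hψ : IsC2 ψ) (hx : x ≠ 0) : homHess ψ x x = 0 := by
  have h1 : HasDerivAt (fun t : ℝ => t • x) x 1 := by
    simpa using (hasDerivAt_id (1 : ℝ)).smul_const x
  have hx' : (1 : ℝ) • x ≠ 0 := by simpa using hx
  have h2 := (hψ.hasFDerivAt_homGrad hx').comp_hasDerivAt (1 : ℝ) h1
  have h3 : (homGrad ψ ∘ fun t : ℝ => t • x) =ᶠ[𝓝 1] fun t => homGrad ψ x := by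
    filter_upwards [isOpen_Ioi.mem_nhds (show (1 : ℝ) ∈ Ioi 0 by simp)] with t ht
    exact homGrad_smul ψ ht hψ hx
  have h4 := (h2.congr_of_eventuallyEq h3.symm).unique (hasDerivAt_const (1 : ℝ) _)
  simpa using h4

lemma inner_homHess_apply (hψ : IsC2 ψ) (hx : x ≠ 0) (v w : Euc n) :
    inner ℝ (homHess ψ x v) w = fderiv ℝ (fderiv ℝ (homExt ψ)) x v w := by
  have h : DifferentiableAt ℝ (fderiv ℝ (homExt ψ)) x :=
    ((hψ.contDiffAt_homExt hx).fderiv_right (m := 1) (by norm_num)).differentiableAt (by norm_num)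
  have h1 : HasFDerivAt (fun y => inner ℝ (homGrad ψ y) w)
      ((innerSL ℝ w).comp (homHess ψ x)) x := by
    have := (innerSL ℝ w).hasFDerivAt.comp x (hψ.hasFDerivAt_homGrad hx)
    refine this.congr_of_eventuallyEq (Eventually.of_forall fun y => ?_)
    simp [real_inner_comm]
  have h2 : HasFDerivAt (fun y => fderiv ℝ (homExt ψ) y w)
      ((fderiv ℝ (fderiv ℝ (homExt ψ)) x).flip w) x := by
    simpa using h.hasFDerivAt.clm_apply (hasFDerivAt_const w x)
  have h3 : (fun y => inner ℝ (homGrad ψ y) w) = fun y => fderiv ℝ (homExt ψ) y w := by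
    funext y
    exact inner_gradient_left
  rw [h3] at h1
  have h4 := congrArg (fun L => L v) (h1.unique h2)
  simpa [real_inner_comm] using h4

lemma homHess_symm (hψ : IsC2 ψ) (hx : x ≠ 0) (v w : Euc n) :
    inner ℝ (homHess ψ x v) w = inner ℝ v (homHess ψ x w) := by
  rw [real_inner_comm (homHess ψ x w), inner_homHess_apply hψ hx, inner_homHess_apply hψ hx]
  exact (hψ.contDiffAt_homExt hx).isSymmSndFDerivAt (by simp) v w

lemma inner_homHess_self (hψ : IsC2 ψ) (hx : x ≠ 0) (v : Euc n) :
    inner ℝ (homHess ψ x v) x = 0 := by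
  rw [homHess_symm hψ hx, homHess_apply_self hψ hx, inner_zero_right]

lemma IsC2.add_smul (hf : IsC2 f) (hg : IsC2 g) (t : ℝ) : IsC2 (f + t • g) := by
  have h : ContMDiff (𝓡 (n - 1)) 𝓘(ℝ, ℝ) 2 (fun _ : USphere n => t) := contMDiff_const
  exact ContMDiff.add hf (h.smul hg)

lemma homGrad_add_smul (hf : IsC2 f) (hg : IsC2 g) (t : ℝ) (hx : x ≠ 0) :
    homGrad (f + t • g) x = homGrad f x + t • homGrad g x := by
  have h1 := (hf.add_smul hg t).hasFDerivAt_homExt hx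
  rw [homExt_add_smul] at h1
  have h2 := h1.unique ((hf.hasFDerivAt_homExt hx).add ((hg.hasFDerivAt_homExt hx).const_smul t))
  refine ext_inner_right ℝ fun v => ?_
  have h3 := congrArg (fun L => L v) h2
  simpa [inner_add_left, inner_smul_left] using h3

lemma homHess_add_smul (hf : IsC2 f) (hg : IsC2 g) (t : ℝ) (hx : x ≠ 0) :
    homHess (f + t • g) x = homHess f x + t • homHess g x := by
  have h1 := (hf.add_smul hg t).hasFDerivAt_homGrad hx
  have h2 := (hf.hasFDerivAt_homGrad hx).add ((hg.hasFDerivAt_homGrad hx).const_smul t)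
  refine h1.unique (h2.congr_of_eventuallyEq ?_)
  filter_upwards [isOpen_ne.mem_nhds hx] with y hy
  exact homGrad_add_smul hf hg t hy

end

/-! ### Bodies cut out by functions on the sphere; convexity from positive curvature -/

noncomputable section

open Filter Topology

variable {n : ℕ} {f g h ψ : USphere n → ℝ}

/-- Positivity of the Hessian of the one-homogeneous extension in all tangential directions. -/
def HasPosCurv (ψ : USphere n → ℝ) : Prop :=
  ∀ (u : USphere n) (v : Euc n), v ≠ 0 → inner ℝ v (u : Euc n) = 0 →
    0 < inner ℝ (homHess ψ (u : Euc n) v) v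

lemma IsC2.continuous [NeZero n] (hψ : IsC2 ψ) : Continuous ψ := ContMDiff.continuous hψ

section Body

lemma isClosed_bodyOf (h : USphere n → ℝ) : IsClosed (bodyOf h) := by
  simp only [bodyOf, ofPred_forall]
  exact isClosed_iInter fun u => isClosed_le (by fun_prop) continuous_const

lemma convex_bodyOf (h : USphere n → ℝ) : Convex ℝ (bodyOf h) := by
  intro x hx y hy a b ha hb hab u
  rw [inner_add_left, inner_smul_left, inner_smul_left]
  calc _ ≤ a * h u + b * h u :=
        add_le_add (mul_le_mul_of_nonneg_left (hx u) ha) (mul_le_mul_of_nonneg_left (hy u) hb)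
    _ = h u := by rw [← add_mul, hab, one_mul]

lemma bodyOf_mono (hfg : f ≤ g) : bodyOf f ⊆ bodyOf g := fun _ hx u => (hx u).trans (hfg u)

lemma inner_unitDir (x : Euc n) (hx : x ≠ 0) : inner ℝ x (unitDir x hx : Euc n) = ‖x‖ := by
  simp only [unitDir, inner_smul_right, real_inner_self_eq_norm_sq]
  have := norm_ne_zero_iff.mpr hx
  field_simp

lemma nontrivial_Euc [NeZero n] : Nontrivial (Euc n) := by
  apply Module.nontrivial_of_finrank_pos (R := ℝ)
  rw [finrank_euclideanSpace_fin]
  exact NeZero.pos n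

lemma isBounded_bodyOf (hh : Continuous h) : Bornology.IsBounded (bodyOf h) := by
  obtain ⟨M, hM⟩ := (isCompact_range hh).bddAbove
  rw [isBounded_iff_forall_norm_le]
  refine ⟨max M 0, fun x hx => ?_⟩
  by_cases hx0 : x = 0
  · simp [hx0]
  · refine le_max_of_le_left ?_
    have h1 := (hx (unitDir x hx0)).trans (hM ⟨_, rfl⟩)
    rwa [inner_unitDir] at h1

lemma isCompact_bodyOf (hh : Continuous h) : IsCompact (bodyOf h) :=
  isCompact_of_isClosed_isBounded (isClosed_bodyOf h) (isBounded_bodyOf hh)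

lemma volume_bodyOf_lt_top (hh : Continuous h) : volume (bodyOf h) < ⊤ :=
  (isCompact_bodyOf hh).measure_lt_top

lemma isSymmetricSet_bodyOf (hh : IsEvenFn h) : IsSymmetricSet (bodyOf h) := by
  intro x hx u
  have h1 := hx (-u)
  rw [hh u] at h1
  simpa using h1

lemma nonempty_USphere [NeZero n] : Nonempty (USphere n) := by
  have : Nontrivial (Euc n) := nontrivial_Euc
  exact (NormedSpace.sphere_nonempty.mpr zero_le_one).to_subtype

lemma interior_bodyOf_nonempty [NeZero n] (hh : Continuous h) (hpos : ∀ u, 0 < h u) :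
    (interior (bodyOf h)).Nonempty := by
  have := nonempty_USphere (n := n)
  obtain ⟨u₀, -, hu₀⟩ := isCompact_univ.exists_isMinOn univ_nonempty hh.continuousOn
  refine ⟨0, mem_interior_iff_mem_nhds.mpr ?_⟩
  refine mem_of_superset (ball_mem_nhds (0 : Euc n) (hpos u₀)) fun x hx u => ?_
  rw [mem_ball_zero_iff] at hx
  calc inner ℝ x (u : Euc n) ≤ ‖x‖ * ‖(u : Euc n)‖ := real_inner_le_norm _ _
    _ = ‖x‖ := by rw [u.norm_coe, mul_one]
    _ ≤ h u := hx.le.trans (hu₀ (mem_univ u))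

lemma isConvexBody_bodyOf [NeZero n] (hh : Continuous h) (hpos : ∀ u, 0 < h u) :
    IsConvexBody (bodyOf h) :=
  ⟨convex_bodyOf h, isCompact_bodyOf hh, interior_bodyOf_nonempty hh hpos⟩

end Body

section Convexity

lemma linearIndependent_of_unit {u v : USphere n} (h1 : v ≠ u) (h2 : v ≠ -u) :
    LinearIndependent ℝ ![(u : Euc n), (v : Euc n)] := by
  rw [LinearIndependent.pair_iff]
  intro a b hab
  have h3 : a • (u : Euc n) = -(b • (v : Euc n)) := eq_neg_of_add_eq_zero_left hab
  have h4 : |a| = |b| := by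
    have := congrArg norm h3
    simpa [norm_smul] using this
  by_cases hb : b = 0
  · subst hb
    simpa using h4
  · exfalso
    rcases abs_eq_abs.mp h4 with h5 | h5
    · rw [h5, ← smul_neg] at h3
      have h6 := smul_right_injective (Euc n) hb h3
      exact h2 (Subtype.ext (by simp [h6]))
    · rw [h5, neg_smul, neg_inj] at h3
      exact h1 (Subtype.ext (smul_right_injective (Euc n) hb h3).symm)

variable [NeZero n]

/-- The radial component of `v` contributes nothing, by Euler's identity and symmetry of the
Hessian, and homogeneity of degree `-1` reduces to a unit base point. -/
lemma HasPosCurv.inner_pos (hp : HasPosCurv ψ) (hψ : IsC2 ψ) {x v : Euc n} (hx : x ≠ 0)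
    (hv : ∀ c : ℝ, v ≠ c • x) : 0 < inner ℝ (homHess ψ x v) v := by
  have hx' : (0 : ℝ) < ‖x‖ := norm_pos_iff.mpr hx
  set u : USphere n := unitDir x hx
  have hxu : x = ‖x‖ • (u : Euc n) := (norm_smul_unitDir x hx).symm
  set c : ℝ := inner ℝ v (u : Euc n)
  set w : Euc n := v - c • (u : Euc n)
  have hw : inner ℝ w (u : Euc n) = 0 := by
    simp only [w, inner_sub_left, inner_smul_left, real_inner_self_eq_norm_sq, u.norm_coe]
    simp [c]
  have hw0 : w ≠ 0 := by
    intro h0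
    refine hv (c * ‖x‖⁻¹) ?_
    rw [sub_eq_zero.mp h0]
    simp only [u, unitDir, smul_smul]
  have hvw : v = w + c • (u : Euc n) := by simp [w]
  have h1 := hp u w hw0 hw
  have hA : homHess ψ x = ‖x‖⁻¹ • homHess ψ (u : Euc n) := by
    conv_lhs => rw [hxu]
    exact homHess_smul ψ hx' hψ u.coe_ne_zero
  have h2 : inner ℝ (homHess ψ (u : Euc n) v) v = inner ℝ (homHess ψ (u : Euc n) w) w := by
    rw [hvw, map_add, map_smul, homHess_apply_self hψ u.coe_ne_zero, smul_zero, add_zero,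
      inner_add_right, inner_smul_right, inner_homHess_self hψ u.coe_ne_zero, mul_zero, add_zero]
  rw [hA, smul_apply, inner_smul_left, h2]
  exact mul_pos (by simpa using hx) h1

/-- Strict supporting hyperplane inequality for linearly independent points. -/
lemma HasPosCurv.inner_homGrad_lt_homExt (hp : HasPosCurv ψ) (hψ : IsC2 ψ) {x y : Euc n}
    (hxy : LinearIndependent ℝ ![x, y]) : inner ℝ (homGrad ψ x) y < homExt ψ y := by
  rw [LinearIndependent.pair_iff] at hxy
  have hx : x ≠ 0 := by
    rintro rfl
    simpa using hxy 1 0 (by simp)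
  set c : ℝ → Euc n := fun t => x + t • (y - x)
  have hc : ∀ t, c t = (1 - t) • x + t • y := fun t => by
    simp only [c, smul_sub, sub_smul, one_smul]; abel
  have hc0 : ∀ t, c t ≠ 0 := by
    intro t h0
    have := hxy (1 - t) t (by rw [← hc]; exact h0)
    linarith [this.1, this.2]
  have hcd : ∀ t, HasDerivAt c (y - x) t := fun t => by
    simpa [c] using ((hasDerivAt_id t).smul_const (y - x)).const_add x
  have h1 : ∀ t, HasDerivAt (fun s => homExt ψ (c s)) (inner ℝ (homGrad ψ (c t)) (y - x)) t :=
    fun t => (hψ.hasFDerivAt_homExt (hc0 t)).comp_hasDerivAt t (hcd t)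
  have h2 : ∀ t, HasDerivAt (fun s => inner ℝ (homGrad ψ (c s)) (y - x))
      (inner ℝ (homHess ψ (c t) (y - x)) (y - x)) t := fun t => by
    simpa using ((hψ.hasFDerivAt_homGrad (hc0 t)).comp_hasDerivAt t (hcd t)).inner ℝ
      (hasDerivAt_const t (y - x))
  -- The segment from `x` to `y` misses the origin and is nowhere radial, by linear independence, so
  -- the second derivative along it is positive. The mean value theorem then compares the chord with
  -- the slope at `x`, and Euler's identity removes the terms at `x`.
  have h3 : StrictMono fun s => inner ℝ (homGrad ψ (c s)) (y - x) := by
    refine strictMono_of_deriv_pos fun t => ?_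
    rw [(h2 t).deriv]
    refine hp.inner_pos hψ (hc0 t) fun a ha => ?_
    rw [hc] at ha
    have := hxy (-1 - a * (1 - t)) (1 - a * t) (by
      have h0 : (y - x) - a • ((1 - t) • x + t • y) = 0 := sub_eq_zero.mpr ha
      rw [← h0]
      module)
    have ha0 : a = 0 := by linarith [this.1, this.2]
    simp [ha0] at this
  obtain ⟨t, ht, hslope⟩ := exists_hasDerivAt_eq_slope (fun s => homExt ψ (c s))
    (fun t => inner ℝ (homGrad ψ (c t)) (y - x)) zero_lt_one
    (fun t _ => (h1 t).continuousAt.continuousWithinAt) (fun t _ => h1 t)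
  have h4 := h3 ht.1
  have hc1 : c 1 = y := by simp [c]
  have hc0' : c 0 = x := by simp [c]
  simp only [hc1, hc0', sub_zero, div_one] at hslope h4
  rw [hslope, inner_sub_right, inner_homGrad_self hψ hx] at h4
  linarith

lemma exists_unit_orthogonal (hn : 2 ≤ n) (u : USphere n) :
    ∃ v : USphere n, inner ℝ (v : Euc n) (u : Euc n) = 0 := by
  have h1 : finrank ℝ (ℝ ∙ (u : Euc n))ᗮ = n - 1 :=
    Submodule.finrank_orthogonal_span_singleton u.coe_ne_zero
  have : Nontrivial (ℝ ∙ (u : Euc n))ᗮ :=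
    Module.nontrivial_of_finrank_pos (R := ℝ) (by omega)
  obtain ⟨w, hw⟩ := exists_ne (0 : (ℝ ∙ (u : Euc n))ᗮ)
  have hw' : (w : Euc n) ≠ 0 := by simpa using hw
  refine ⟨unitDir w hw', ?_⟩
  have h2 : inner ℝ (w : Euc n) (u : Euc n) = 0 := by
    rw [real_inner_comm]
    exact Submodule.mem_orthogonal_singleton_iff_inner_right.mp w.2
  simp [unitDir, inner_smul_left, h2]

/-- Antipodal points are linearly dependent, so the strict supporting inequality does not compare
them directly. Supporting instead at a unit vector `v` orthogonal to `u`, which exists because `n ≥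
2`, bounds both `ψ u` and `ψ (-u)` below, and the bounds add up to zero. For even `ψ` this is
positivity. -/
lemma HasPosCurv.neg_lt (hn : 2 ≤ n) (hp : HasPosCurv ψ) (hψ : IsC2 ψ) (u : USphere n) :
    -ψ u < ψ (-u) := by
  obtain ⟨v, hv⟩ := exists_unit_orthogonal hn u
  have key : ∀ w : USphere n, inner ℝ (v : Euc n) (w : Euc n) = 0 →
      inner ℝ (homGrad ψ v) (w : Euc n) < ψ w := by
    intro w hw
    rw [← homExt_coe ψ w]
    refine hp.inner_homGrad_lt_homExt hψ (linearIndependent_of_unit ?_ ?_)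
    · rintro rfl
      simp at hw
    · rintro rfl
      simp at hw
  have h1 := key u hv
  have h2 := key (-u) (by simpa using hv)
  simp only [coe_neg_sphere, inner_neg_right] at h2
  linarith

/-- Strict supporting hyperplane inequality on the sphere. -/
lemma HasPosCurv.inner_homGrad_lt (hn : 2 ≤ n) (hp : HasPosCurv ψ) (hψ : IsC2 ψ) {u v : USphere n}
    (huv : v ≠ u) : inner ℝ (homGrad ψ u) (v : Euc n) < ψ v := by
  by_cases h : v = -u
  · subst h
    rw [coe_neg_sphere, inner_neg_right, inner_homGrad_self hψ u.coe_ne_zero, homExt_coe]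
    exact hp.neg_lt hn hψ u
  · rw [← homExt_coe ψ v]
    exact hp.inner_homGrad_lt_homExt hψ (linearIndependent_of_unit huv h)

lemma inner_homGrad_coe (hψ : IsC2 ψ) (u : USphere n) :
    inner ℝ (homGrad ψ u) (u : Euc n) = ψ u := by
  rw [inner_homGrad_self hψ u.coe_ne_zero, homExt_coe]

lemma HasPosCurv.homGrad_mem_bodyOf (hn : 2 ≤ n) (hp : HasPosCurv ψ) (hψ : IsC2 ψ)
    (u : USphere n) : homGrad ψ u ∈ bodyOf ψ := by
  intro v
  by_cases h : v = u
  · rw [h, inner_homGrad_coe hψ]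
  · exact (hp.inner_homGrad_lt hn hψ h).le

lemma HasPosCurv.supportFn_bodyOf (hn : 2 ≤ n) (hp : HasPosCurv ψ) (hψ : IsC2 ψ) :
    supportFn (bodyOf ψ) = ψ := by
  funext u
  refine IsGreatest.csSup_eq ⟨⟨homGrad ψ u, hp.homGrad_mem_bodyOf hn hψ u,
    inner_homGrad_coe hψ u⟩, ?_⟩
  rintro _ ⟨x, hx, rfl⟩
  exact hx u

lemma HasPosCurv.pos (hn : 2 ≤ n) (hp : HasPosCurv ψ) (hψ : IsC2 ψ) (he : IsEvenFn ψ)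
    (u : USphere n) : 0 < ψ u := by
  have h1 := hp.neg_lt hn hψ u
  rw [he u] at h1
  linarith

end Convexity

end

/-! ### The curvature determinant and the shell map -/

noncomputable section

open Filter Topology

variable {n : ℕ} {f g h ψ : USphere n → ℝ}

/-- The product of the principal radii of curvature, as the determinant of the Hessian of the
one-homogeneous extension completed by the identity in the radial direction. -/
def curvDet (ψ : USphere n → ℝ) (u : USphere n) : ℝ :=
  (homHess ψ (u : Euc n) + (innerSL ℝ (u : Euc n)).smulRight (u : Euc n)).det

/-- Since `M` preserves `u^⊥`, its matrix in the orthonormal basis formed by `u` and the frame is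
block triangular. -/
lemma det_eq_of_invariant_orthogonal (u : USphere n) [NeZero n]
    (e : OrthonormalBasis (Fin (n - 1)) ℝ ((ℝ ∙ (u : Euc n))ᗮ : Submodule ℝ (Euc n)))
    (M : Euc n →L[ℝ] Euc n) (hM : ∀ v : Euc n, inner ℝ v (u : Euc n) = 0 →
      inner ℝ (M v) (u : Euc n) = 0) :
    M.det = inner ℝ (u : Euc n) (M u) *
      (Matrix.of fun i j => inner ℝ (e i : Euc n) (M (e j : Euc n))).det := by
  have he : ∀ i, inner ℝ (e i : Euc n) (u : Euc n) = 0 := fun i => by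
    rw [real_inner_comm]
    exact Submodule.mem_orthogonal_singleton_iff_inner_right.mp (e i).2
  let v : Unit ⊕ Fin (n - 1) → Euc n := Sum.elim (fun _ => (u : Euc n)) (fun i => (e i : Euc n))
  have hv : Orthonormal ℝ v := by
    rw [orthonormal_iff_ite]
    rintro (i | i) (j | j)
    · simp [v]
    · simpa [v, real_inner_comm] using he j
    · simpa [v] using he i
    · have := orthonormal_iff_ite.mp e.orthonormal i j
      simpa [v] using this
  have hcard : Fintype.card (Unit ⊕ Fin (n - 1)) = finrank ℝ (Euc n) := by
    have := NeZero.pos n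
    simp
    omega
  let b : OrthonormalBasis (Unit ⊕ Fin (n - 1)) ℝ (Euc n) :=
    (basisOfOrthonormalOfCardEqFinrank hv hcard).toOrthonormalBasis (by simpa using hv)
  have hb : ∀ i, b i = v i := fun i => by simp [b]
  have h1 : LinearMap.toMatrix b.toBasis b.toBasis (M : Euc n →ₗ[ℝ] Euc n) =
      Matrix.fromBlocks (Matrix.of fun _ _ => inner ℝ (u : Euc n) (M u)) 0
        (Matrix.of fun i _ => inner ℝ (e i : Euc n) (M u))
        (Matrix.of fun i j => inner ℝ (e i : Euc n) (M (e j : Euc n))) := by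
    ext (i | i) (j | j)
    · simp [LinearMap.toMatrix_apply, OrthonormalBasis.repr_apply_apply, hb, v]
    · simpa [LinearMap.toMatrix_apply, OrthonormalBasis.repr_apply_apply, hb, v, real_inner_comm]
        using hM _ (he j)
    · simp [LinearMap.toMatrix_apply, OrthonormalBasis.repr_apply_apply, hb, v]
    · simp [LinearMap.toMatrix_apply, OrthonormalBasis.repr_apply_apply, hb, v]
  have h2 : M.det = LinearMap.det (M : Euc n →ₗ[ℝ] Euc n) := rfl
  rw [h2, ← LinearMap.det_toMatrix b.toBasis, h1, Matrix.det_fromBlocks_zero₁₂]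
  simp

/-- A choice of frame. -/
def stdFrame (n : ℕ) [NeZero n] : SphereFrame n := fun u =>
  (stdOrthonormalBasis ℝ ((ℝ ∙ (u : Euc n))ᗮ : Submodule ℝ (Euc n))).reindex
    (finCongr (Submodule.finrank_orthogonal_span_singleton u.coe_ne_zero))

section Det

lemma continuous_rankOne : Continuous fun u : USphere n =>
    (innerSL ℝ (u : Euc n)).smulRight (u : Euc n) := by fun_prop

variable [NeZero n]

lemma curvDet_eq_det (hψ : IsC2 ψ) (e : SphereFrame n) (u : USphere n) :
    curvDet ψ u = (Matrix.of fun i j =>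
      inner ℝ (e u i : Euc n) (homHess ψ (u : Euc n) (e u j : Euc n))).det := by
  have he : ∀ i, inner ℝ (u : Euc n) (e u i : Euc n) = 0 := fun i =>
    Submodule.mem_orthogonal_singleton_iff_inner_right.mp (e u i).2
  rw [curvDet, det_eq_of_invariant_orthogonal u (e u)]
  · simp [he, homHess_apply_self hψ u.coe_ne_zero]
  · intro v hv
    simp [inner_homHess_self hψ u.coe_ne_zero, real_inner_comm, hv]

/-- The Hessian kills `u` and the rank-one term kills `u^⊥`, so the radial entry is `⟨u, w⟩` and the
tangential block is `r` times that of the Hessian. Taking `w = ∇g(u)` gives the Jacobian of the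
shell map, and `w = u` gives the scaling of `curvDet`. -/
lemma det_smul_homHess_add (hψ : IsC2 ψ) (u : USphere n) (r : ℝ) (w : Euc n) :
    (r • homHess ψ (u : Euc n) + (innerSL ℝ (u : Euc n)).smulRight w).det =
      inner ℝ (u : Euc n) w * (r ^ (n - 1) * curvDet ψ u) := by
  have he : ∀ i, inner ℝ (u : Euc n) (stdFrame n u i : Euc n) = 0 := fun i =>
    Submodule.mem_orthogonal_singleton_iff_inner_right.mp (stdFrame n u i).2
  rw [det_eq_of_invariant_orthogonal u (stdFrame n u), curvDet_eq_det hψ (stdFrame n)]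
  · have h1 : (Matrix.of fun i j => inner ℝ (stdFrame n u i : Euc n)
        ((r • homHess ψ (u : Euc n) + (innerSL ℝ (u : Euc n)).smulRight w)
          (stdFrame n u j : Euc n))) =
        r • (Matrix.of fun i j => inner ℝ (stdFrame n u i : Euc n)
          (homHess ψ (u : Euc n) (stdFrame n u j : Euc n))) := by
      ext i j
      simp [he, inner_smul_right]
    rw [h1, Matrix.det_smul, Fintype.card_fin]
    simp [homHess_apply_self hψ u.coe_ne_zero]
  · intro v hv
    have hv' : inner ℝ (u : Euc n) v = 0 := by rw [real_inner_comm]; exact hv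
    simp [inner_smul_left, inner_homHess_self hψ u.coe_ne_zero, hv']

lemma HasPosCurv.curvDet_pos (hp : HasPosCurv ψ) (hψ : IsC2 ψ) (u : USphere n) :
    0 < curvDet ψ u := by
  rw [curvDet_eq_det hψ (stdFrame n)]
  apply Matrix.PosDef.det_pos
  refine Matrix.PosDef.of_dotProduct_mulVec_pos ?_ fun x hx => ?_
  · ext i j
    simp only [Matrix.conjTranspose_apply, Matrix.of_apply, star_trivial]
    rw [← homHess_symm hψ u.coe_ne_zero, real_inner_comm]
  · set v : Euc n := ∑ i, x i • (stdFrame n u i : Euc n) with hv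
    have hv0 : v ≠ 0 := by
      intro h0
      have h1 : ∑ i, x i • (stdFrame n u i) = 0 := by
        apply Subtype.ext
        simpa [hv] using h0
      have h2 := Fintype.linearIndependent_iff.mp
        (stdFrame n u).toBasis.linearIndependent x (by simpa using h1)
      exact hx (funext h2)
    have hvu : inner ℝ v (u : Euc n) = 0 := by
      rw [hv, sum_inner]
      refine Finset.sum_eq_zero fun i _ => ?_
      rw [inner_smul_left, real_inner_comm,
        Submodule.mem_orthogonal_singleton_iff_inner_right.mp (stdFrame n u i).2, mul_zero]
    have h3 := hp u v hv0 hvu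
    rw [real_inner_comm] at h3
    refine lt_of_lt_of_eq h3 (Eq.symm ?_)
    simp only [hv, map_sum, map_smul, sum_inner, inner_sum, inner_smul_left, inner_smul_right,
      dotProduct, Matrix.mulVec, Matrix.of_apply, Finset.mul_sum, star_trivial, RCLike.conj_to_real]
    refine Finset.sum_congr rfl fun i _ => Finset.sum_congr rfl fun j _ => ?_
    rw [← homHess_symm hψ u.coe_ne_zero (stdFrame n u i), real_inner_comm]
    ring

lemma continuous_homHess_coe (hψ : IsC2 ψ) :
    Continuous fun u : USphere n => homHess ψ (u : Euc n) :=
  continuous_iff_continuousAt.mpr fun u =>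
    (hψ.continuousAt_homHess u.coe_ne_zero).comp continuous_subtype_val.continuousAt

lemma continuous_curvDet (hψ : IsC2 ψ) : Continuous (curvDet ψ) :=
  ContinuousLinearMap.continuous_det.comp ((continuous_homHess_coe hψ).add continuous_rankOne)

lemma continuous_curvDet_add_smul (hf : IsC2 f) (hg : IsC2 g) :
    Continuous fun p : ℝ × USphere n => curvDet (f + p.1 • g) p.2 := by
  have h1 : (fun p : ℝ × USphere n => curvDet (f + p.1 • g) p.2) = fun p : ℝ × USphere n =>
      (homHess f (p.2 : Euc n) + p.1 • homHess g (p.2 : Euc n) +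
        (innerSL ℝ (p.2 : Euc n)).smulRight (p.2 : Euc n)).det := by
    funext p
    rw [curvDet, homHess_add_smul hf hg p.1 p.2.coe_ne_zero]
  rw [h1]
  refine ContinuousLinearMap.continuous_det.comp (((((continuous_homHess_coe hf).comp
    continuous_snd).add (continuous_fst.smul ((continuous_homHess_coe hg).comp
    continuous_snd)))).add (continuous_rankOne.comp continuous_snd))

end Det

section Shell

lemma hasFDerivAt_norm_of_ne_zero {x : Euc n} (hx : x ≠ 0) :
    HasFDerivAt (fun y : Euc n => ‖y‖) (‖x‖⁻¹ • innerSL ℝ x) x := by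
  have h1 : HasFDerivAt (fun y : Euc n => ‖y‖ ^ 2) (2 • innerSL ℝ x) x :=
    (hasStrictFDerivAt_norm_sq x).hasFDerivAt
  have h2 := h1.sqrt (by simpa using hx)
  have h3 : (fun y : Euc n => √(‖y‖ ^ 2)) = fun y => ‖y‖ := by
    funext y; exact Real.sqrt_sq (norm_nonneg y)
  rw [h3, Real.sqrt_sq (norm_nonneg x)] at h2
  refine h2.congr_fderiv ?_
  rw [← Nat.cast_smul_eq_nsmul ℝ, smul_smul]
  congr 1
  have := norm_ne_zero_iff.mpr hx
  push_cast
  field_simp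

variable [NeZero n]

/-- The map which sends `r u` to the boundary point with normal `u` of the body with support
function `f + r g`. -/
def shellMap (f g : USphere n → ℝ) (x : Euc n) : Euc n := homGrad f x + ‖x‖ • homGrad g x

lemma shellMap_smul (hf : IsC2 f) (hg : IsC2 g) {r : ℝ} (hr : 0 < r) (u : USphere n) :
    shellMap f g (r • (u : Euc n)) = homGrad (f + r • g) u := by
  rw [shellMap, homGrad_smul f hr hf u.coe_ne_zero, homGrad_smul g hr hg u.coe_ne_zero,
    homGrad_add_smul hf hg r u.coe_ne_zero, norm_smul, u.norm_coe, mul_one,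
    Real.norm_of_nonneg hr.le]

/-- The derivative of the shell map. -/
def shellDeriv (f g : USphere n → ℝ) (x : Euc n) : Euc n →L[ℝ] Euc n :=
  homHess f x + (‖x‖ • homHess g x + (‖x‖⁻¹ • innerSL ℝ x).smulRight (homGrad g x))

lemma hasFDerivAt_shellMap (hf : IsC2 f) (hg : IsC2 g) {x : Euc n} (hx : x ≠ 0) :
    HasFDerivAt (shellMap f g) (shellDeriv f g x) x :=
  (hf.hasFDerivAt_homGrad hx).add
    ((hasFDerivAt_norm_of_ne_zero hx).smul (hg.hasFDerivAt_homGrad hx))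

/-- The radial entry is `⟨u, ∇g(u)⟩`, which equals `g u` by Euler's identity; each of the `n - 1`
tangential directions contributes a factor `r⁻¹`. -/
lemma det_shellDeriv (hf : IsC2 f) (hg : IsC2 g) {r : ℝ} (hr : 0 < r) (u : USphere n) :
    (shellDeriv f g (r • (u : Euc n))).det =
      g u * ((r⁻¹) ^ (n - 1) * curvDet (f + r • g) u) := by
  have h1 : shellDeriv f g (r • (u : Euc n)) = r⁻¹ • homHess (f + r • g) (u : Euc n) +
      (innerSL ℝ (u : Euc n)).smulRight (homGrad g u) := by
    rw [shellDeriv, homHess_smul f hr hf u.coe_ne_zero, homHess_smul g hr hg u.coe_ne_zero,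
      homGrad_smul g hr hg u.coe_ne_zero, homHess_add_smul hf hg r u.coe_ne_zero, norm_smul,
      u.norm_coe, mul_one, Real.norm_of_nonneg hr.le, smul_add, add_assoc]
    congr 2
    · rw [smul_comm]
    · rw [map_smul, smul_smul, inv_mul_cancel₀ hr.ne', one_smul]
  rw [h1, det_smul_homHess_add (hf.add_smul hg r), real_inner_comm, inner_homGrad_coe hg]

/-- The image of `r u` lies in the body of parameter `r` and touches its supporting hyperplane with
normal `u`. As `g > 0`, it belongs to no body of smaller parameter, which determines `r`; strictness
of the supporting inequality then determines `u`. -/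
lemma injOn_shellMap (hn : 2 ≤ n) (hf : IsC2 f) (hg : IsC2 g) (hg0 : ∀ u, 0 < g u) {s : ℝ}
    (hp : ∀ r ∈ Ioc 0 s, HasPosCurv (f + r • g)) :
    InjOn (shellMap f g) (closedBall 0 s \ {0}) := by
  have key : ∀ r ∈ Ioc 0 s, ∀ r' ∈ Ioc 0 s, r ≤ r' → ∀ u u' : USphere n,
      homGrad (f + r • g) u = homGrad (f + r' • g) u' → r = r' ∧ u = u' := by
    intro r hr r' hr' hrr u u' heq
    have h1 := (hp r hr).homGrad_mem_bodyOf hn (hf.add_smul hg r) u u'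
    have h2 := inner_homGrad_coe (hf.add_smul hg r') u'
    have h3 : r = r' := by
      rw [heq, h2] at h1
      simp only [Pi.add_apply, Pi.smul_apply, smul_eq_mul] at h1
      exact le_antisymm hrr (le_of_mul_le_mul_right (by linarith) (hg0 u'))
    refine ⟨h3, ?_⟩
    subst h3
    by_contra hne
    have h4 := (hp r hr).inner_homGrad_lt hn (hf.add_smul hg r) (Ne.symm hne)
    rw [heq, h2] at h4
    exact lt_irrefl _ h4
  intro x hx y hy hxy
  have hx0 : x ≠ 0 := hx.2
  have hy0 : y ≠ 0 := hy.2
  have hrx : ‖x‖ ∈ Ioc 0 s := ⟨norm_pos_iff.mpr hx0, mem_closedBall_zero_iff.mp hx.1⟩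
  have hry : ‖y‖ ∈ Ioc 0 s := ⟨norm_pos_iff.mpr hy0, mem_closedBall_zero_iff.mp hy.1⟩
  rw [← norm_smul_unitDir x hx0, ← norm_smul_unitDir y hy0, shellMap_smul hf hg hrx.1,
    shellMap_smul hf hg hry.1] at hxy
  have h5 : ‖x‖ = ‖y‖ ∧ unitDir x hx0 = unitDir y hy0 := by
    rcases le_total ‖x‖ ‖y‖ with h | h
    · exact key _ hrx _ hry h _ _ hxy
    · obtain ⟨a, b⟩ := key _ hry _ hrx h _ _ hxy.symm
      exact ⟨a.symm, b.symm⟩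
  rw [← norm_smul_unitDir x hx0, ← norm_smul_unitDir y hy0, h5.1, h5.2]

/-- The homogeneous function `homExt f - ⟨y, ·⟩` is nonnegative off the origin and vanishes at `u`,
so its gradient vanishes there. -/
lemma homGrad_eq_of_isMin (hf : IsC2 f) {y : Euc n} (hy : y ∈ bodyOf f) {u : USphere n}
    (hu : inner ℝ y (u : Euc n) = f u) : homGrad f u = y := by
  have h1 : IsLocalMin (fun x => homExt f x - inner ℝ y x) (u : Euc n) := by
    filter_upwards [isOpen_ne.mem_nhds u.coe_ne_zero] with x hx
    rw [homExt_coe, hu, sub_self, homExt_of_ne_zero f hx]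
    have h2 := hy (unitDir x hx)
    have h3 : inner ℝ y x = ‖x‖ * inner ℝ y (unitDir x hx : Euc n) := by
      rw [← inner_smul_right, norm_smul_unitDir]
    rw [h3, ← mul_sub]
    exact mul_nonneg (norm_nonneg x) (sub_nonneg.mpr h2)
  have h4 : HasFDerivAt (fun x => homExt f x - inner ℝ y x)
      (innerSL ℝ (homGrad f u) - innerSL ℝ y) (u : Euc n) :=
    (hf.hasFDerivAt_homExt u.coe_ne_zero).sub (innerSL ℝ y).hasFDerivAt
  have h5 := h1.hasFDerivAt_eq_zero h4
  refine ext_inner_right ℝ fun v => ?_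
  have h6 := congrArg (fun L => L v) h5
  simpa [sub_eq_zero] using h6

lemma image_shellMap (hn : 2 ≤ n) (hf : IsC2 f) (hg : IsC2 g) (hg0 : ∀ u, 0 < g u) {s : ℝ}
    (hp : ∀ r ∈ Ioc 0 s, HasPosCurv (f + r • g)) :
    shellMap f g '' (closedBall 0 s \ {0}) = bodyOf (f + s • g) \ bodyOf f := by
  apply Subset.antisymm
  · rintro _ ⟨x, hx, rfl⟩
    have hx0 : x ≠ 0 := hx.2
    have hrx : ‖x‖ ∈ Ioc 0 s := ⟨norm_pos_iff.mpr hx0, mem_closedBall_zero_iff.mp hx.1⟩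
    rw [← norm_smul_unitDir x hx0, shellMap_smul hf hg hrx.1]
    refine ⟨?_, fun hmem => ?_⟩
    · refine bodyOf_mono (fun u => ?_) ((hp _ hrx).homGrad_mem_bodyOf hn (hf.add_smul hg _) _)
      have := mul_le_mul_of_nonneg_right hrx.2 (hg0 u).le
      simpa using this
    · have h1 := hmem (unitDir x hx0)
      rw [inner_homGrad_coe (hf.add_smul hg _)] at h1
      have := mul_pos hrx.1 (hg0 (unitDir x hx0))
      simp only [Pi.add_apply, Pi.smul_apply, smul_eq_mul] at h1
      linarith
  · rintro y ⟨hy1, hy2⟩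
    have := nonempty_USphere (n := n)
    -- The preimage of `y` is read off from the smallest `r` whose body contains `y`: this is the
    -- maximum of `(⟨y, v⟩ - f v) / g v`, and a maximizer `u` is a contact direction.
    have hcont : Continuous fun u : USphere n => (inner ℝ y (u : Euc n) - f u) / g u :=
      (((by fun_prop : Continuous fun u : USphere n => inner ℝ y (u : Euc n))).sub
        hf.continuous).div hg.continuous fun u => (hg0 u).ne'
    obtain ⟨u, -, hu⟩ := isCompact_univ.exists_isMaxOn univ_nonempty hcont.continuousOn
    set r : ℝ := (inner ℝ y (u : Euc n) - f u) / g u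
    have hr : ∀ v : USphere n, inner ℝ y (v : Euc n) ≤ f v + r * g v := fun v => by
      have h1 : (inner ℝ y (v : Euc n) - f v) / g v ≤ r := hu (mem_univ v)
      rw [div_le_iff₀ (hg0 v)] at h1
      linarith
    have hru : inner ℝ y (u : Euc n) = f u + r * g u := by
      have := (hg0 u).ne'
      simp only [r]
      field_simp
      ring
    have hr0 : 0 < r := by
      by_contra hle
      refine hy2 fun v => ?_
      have := mul_nonpos_of_nonpos_of_nonneg (not_lt.mp hle) (hg0 v).le
      linarith [hr v]
    have hrs : r ≤ s := by
      have h1 := hy1 u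
      rw [hru] at h1
      simp only [Pi.add_apply, Pi.smul_apply, smul_eq_mul] at h1
      exact le_of_mul_le_mul_right (by linarith) (hg0 u)
    refine ⟨r • (u : Euc n), ⟨?_, ?_⟩, ?_⟩
    · rw [mem_closedBall_zero_iff, norm_smul, u.norm_coe, mul_one, Real.norm_of_nonneg hr0.le]
      exact hrs
    · exact smul_ne_zero hr0.ne' u.coe_ne_zero
    · rw [shellMap_smul hf hg hr0]
      exact homGrad_eq_of_isMin (hf.add_smul hg r) hr hru

end Shell

end

/-! ### Volume of a shell -/

noncomputable section

open Filter Topology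

variable {n : ℕ} {f g h ψ : USphere n → ℝ}

/-- The surface measure of the unit sphere. -/
abbrev sphereMeasure (n : ℕ) : Measure (USphere n) := (volume : Measure (Euc n)).toSphere

/-- Integration in polar coordinates. -/
lemma lintegral_polar (F : Euc n → ENNReal)
    (hF : Measurable fun p : USphere n × Ioi (0 : ℝ) => F (p.2.1 • (p.1 : Euc n))) :
    ∫⁻ x in ({0}ᶜ : Set (Euc n)), F x =
      ∫⁻ r in Ioi (0 : ℝ), ENNReal.ofReal (r ^ (n - 1)) *
        ∫⁻ u, F (r • (u : Euc n)) ∂(sphereMeasure n) := by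
  have h1 := (volume : Measure (Euc n)).measurePreserving_homeomorphUnitSphereProd
  have h2 := h1.lintegral_comp_emb (Homeomorph.measurableEmbedding _)
    (fun p : USphere n × Ioi (0 : ℝ) => F (p.2.1 • (p.1 : Euc n)))
  have h3 : ∀ y : ({0}ᶜ : Set (Euc n)),
      F ((homeomorphUnitSphereProd (Euc n) y).2.1 •
        ((homeomorphUnitSphereProd (Euc n) y).1 : Euc n)) = F y := by
    intro y
    congr 1
    have := congrArg Subtype.val ((homeomorphUnitSphereProd (Euc n)).symm_apply_apply y)
    rwa [homeomorphUnitSphereProd_symm_apply_coe] at this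
  simp only [h3] at h2
  rw [lintegral_subtype_comap (measurableSet_singleton _).compl,
    lintegral_prod_symm' _ hF, finrank_euclideanSpace_fin, Measure.volumeIoiPow,
    lintegral_withDensity_eq_lintegral_mul] at h2
  · rw [h2, ← lintegral_subtype_comap measurableSet_Ioi]
    rfl
  · fun_prop
  · exact Measurable.lintegral_prod_left' hF

lemma continuous_integral_sphere {X : Type*} [TopologicalSpace X] [FirstCountableTopology X]
    [LocallyCompactSpace X] {F : X → USphere n → ℝ} (hF : Continuous F.uncurry) :
    Continuous fun x => ∫ u, F x u ∂(sphereMeasure n) := by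
  simpa using continuous_parametric_integral_of_continuous (μ := sphereMeasure n) hF
    (isCompact_univ (X := USphere n))

lemma integrable_sphere {F : USphere n → ℝ} (hF : Continuous F) :
    Integrable F (sphereMeasure n) := by
  simpa using hF.continuousOn.integrableOn_compact (μ := sphereMeasure n) isCompact_univ

section

variable [NeZero n]

/-- In polar coordinates the weight `r ^ (n - 1)` cancels the factor `r⁻¹ ^ (n - 1)` in the
Jacobian. -/
lemma lintegral_shell (hf : IsC2 f) (hg : IsC2 g) (s : ℝ) :
    ∫⁻ x in closedBall 0 s \ {0}, ENNReal.ofReal |(shellDeriv f g x).det| =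
      ∫⁻ r in Ioc (0 : ℝ) s, ∫⁻ u, ENNReal.ofReal |g u * curvDet (f + r • g) u|
        ∂(sphereMeasure n) := by
  have hcont := continuous_curvDet_add_smul hf hg
  have hgc := hg.continuous
  set F : Euc n → ENNReal :=
    (closedBall 0 s).indicator fun x => ENNReal.ofReal |(shellDeriv f g x).det| with hF
  have hFr : ∀ r : ℝ, 0 < r → ∀ u : USphere n, F (r • (u : Euc n)) = (Iic s).indicator
      (fun r => ENNReal.ofReal |g u * ((r⁻¹) ^ (n - 1) * curvDet (f + r • g) u)|) r := by
    intro r hr u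
    have hmem : r • (u : Euc n) ∈ closedBall (0 : Euc n) s ↔ r ∈ Iic s := by
      rw [mem_closedBall_zero_iff, norm_smul, u.norm_coe, mul_one, Real.norm_of_nonneg hr.le]
      rfl
    by_cases hrs : r ∈ Iic s
    · rw [hF, indicator_of_mem (hmem.mpr hrs), indicator_of_mem hrs, det_shellDeriv hf hg hr]
    · rw [hF, indicator_of_notMem (mt hmem.mp hrs), indicator_of_notMem hrs]
  have h1 : ∫⁻ x in closedBall 0 s \ {0}, ENNReal.ofReal |(shellDeriv f g x).det| =
      ∫⁻ x in ({0}ᶜ : Set (Euc n)), F x := by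
    rw [setLIntegral_indicator measurableSet_closedBall, sdiff_eq]
  rw [h1, lintegral_polar F]
  · have h2 : ∀ r ∈ Ioi (0 : ℝ), ENNReal.ofReal (r ^ (n - 1)) *
        ∫⁻ u, F (r • (u : Euc n)) ∂(sphereMeasure n) = (Iic s).indicator (fun r => ∫⁻ u,
          ENNReal.ofReal |g u * curvDet (f + r • g) u| ∂(sphereMeasure n)) r := by
      intro r hr
      have hr0 : 0 < r := hr
      rw [lintegral_congr (hFr r hr0)]
      by_cases hrs : r ∈ Iic s
      · simp only [indicator_of_mem hrs]
        rw [← lintegral_const_mul' _ _ ENNReal.ofReal_ne_top]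
        refine lintegral_congr fun u => ?_
        have habs : |r ^ (n - 1)| = r ^ (n - 1) := abs_of_nonneg (pow_nonneg hr0.le _)
        rw [← ENNReal.ofReal_mul (pow_nonneg hr0.le _)]
        nth_rewrite 1 [← habs]
        rw [← abs_mul]
        congr 2
        have : r ^ (n - 1) * r⁻¹ ^ (n - 1) = 1 := by
          rw [← mul_pow, mul_inv_cancel₀ hr0.ne', one_pow]
        linear_combination (g u * curvDet (f + r • g) u) * this
      · simp only [indicator_of_notMem hrs, lintegral_zero, mul_zero]
    rw [setLIntegral_congr_fun measurableSet_Ioi h2, setLIntegral_indicator measurableSet_Iic,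
      inter_comm, Ioi_inter_Iic]
  · have h3 : (fun p : USphere n × Ioi (0 : ℝ) => F (p.2.1 • (p.1 : Euc n))) =
        {p : USphere n × Ioi (0 : ℝ) | p.2.1 ≤ s}.indicator fun p => ENNReal.ofReal
          |g p.1 * ((p.2.1⁻¹) ^ (n - 1) * curvDet (f + p.2.1 • g) p.1)| := by
      funext p
      rw [hFr _ p.2.2]
      by_cases hp : p.2.1 ≤ s
      · rw [indicator_of_mem (show p.2.1 ∈ Iic s from hp), indicator_of_mem (by exact hp)]
      · rw [indicator_of_notMem (show p.2.1 ∉ Iic s from hp), indicator_of_notMem (by exact hp)]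
    rw [h3]
    refine Measurable.indicator ?_ (measurableSet_le (by fun_prop) measurable_const)
    have h4 : Measurable fun p : USphere n × Ioi (0 : ℝ) => curvDet (f + p.2.1 • g) p.1 :=
      (hcont.comp ((continuous_subtype_val.comp continuous_snd).prodMk continuous_fst)).measurable
    have h5 : Measurable fun p : USphere n × Ioi (0 : ℝ) => g p.1 :=
      (hgc.comp continuous_fst).measurable
    have h6 : Measurable fun p : USphere n × Ioi (0 : ℝ) => p.2.1 := by fun_prop
    exact ((h5.mul ((h6.inv.pow_const _).mul h4)).norm).ennreal_ofReal

lemma volume_shell (hn : 2 ≤ n) (hf : IsC2 f) (hg : IsC2 g) (hg0 : ∀ u, 0 < g u) {s : ℝ}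
    (hp : ∀ r ∈ Ioc 0 s, HasPosCurv (f + r • g)) :
    volume (bodyOf (f + s • g) \ bodyOf f) =
      ∫⁻ r in Ioc (0 : ℝ) s, ∫⁻ u, ENNReal.ofReal (g u * curvDet (f + r • g) u)
        ∂(sphereMeasure n) := by
  rw [← image_shellMap hn hf hg hg0 hp, ← lintegral_abs_det_fderiv_eq_addHaar_image volume
    (measurableSet_closedBall.diff (measurableSet_singleton _))
    (fun x hx => (hasFDerivAt_shellMap hf hg hx.2).hasFDerivWithinAt)
    (injOn_shellMap hn hf hg hg0 hp), lintegral_shell hf hg]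
  refine setLIntegral_congr_fun measurableSet_Ioc fun r hr => ?_
  refine lintegral_congr fun u => ?_
  rw [abs_of_nonneg]
  exact mul_nonneg (hg0 u).le ((hp r hr).curvDet_pos (hf.add_smul hg r) u).le

/-- The volume of a body with support function `f`. -/
def bodyVol (f : USphere n → ℝ) : ℝ := volume.real (bodyOf f)

lemma bodyVol_add_smul (hn : 2 ≤ n) (hf : IsC2 f) (hg : IsC2 g) (hg0 : ∀ u, 0 < g u) {s : ℝ}
    (hs : 0 ≤ s) (hp : ∀ r ∈ Ioc 0 s, HasPosCurv (f + r • g)) :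
    bodyVol (f + s • g) = bodyVol f +
      ∫ r in 0..s, ∫ u, g u * curvDet (f + r • g) u ∂(sphereMeasure n) := by
  have hsub : bodyOf f ⊆ bodyOf (f + s • g) := bodyOf_mono fun u => by
    simpa using mul_nonneg hs (hg0 u).le
  have hcont := continuous_curvDet_add_smul hf hg
  have hgc := hg.continuous
  have hc2 : Continuous fun p : ℝ × USphere n => g p.2 * curvDet (f + p.1 • g) p.2 :=
    (hgc.comp continuous_snd).mul hcont
  have hP := continuous_integral_sphere (F := fun (r : ℝ) u => g u * curvDet (f + r • g) u) hc2
  have h1 : volume.real (bodyOf (f + s • g) \ bodyOf f) =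
      ∫ r in 0..s, ∫ u, g u * curvDet (f + r • g) u ∂(sphereMeasure n) := by
    rw [Measure.real, volume_shell hn hf hg hg0 hp, intervalIntegral.integral_of_le hs]
    have h2 : ∀ r ∈ Ioc 0 s, ∫⁻ u, ENNReal.ofReal (g u * curvDet (f + r • g) u)
        ∂(sphereMeasure n) =
        ENNReal.ofReal (∫ u, g u * curvDet (f + r • g) u ∂(sphereMeasure n)) := by
      intro r hr
      rw [ofReal_integral_eq_lintegral_ofReal]
      · exact integrable_sphere (hgc.mul (continuous_curvDet (hf.add_smul hg r)))
      · exact Eventually.of_forall fun u =>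
          mul_nonneg (hg0 u).le ((hp r hr).curvDet_pos (hf.add_smul hg r) u).le
    rw [setLIntegral_congr_fun measurableSet_Ioc h2, ← ofReal_integral_eq_lintegral_ofReal,
      ENNReal.toReal_ofReal]
    · refine setIntegral_nonneg measurableSet_Ioc fun r hr => integral_nonneg fun u => ?_
      exact mul_nonneg (hg0 u).le ((hp r hr).curvDet_pos (hf.add_smul hg r) u).le
    · exact hP.integrableOn_Ioc
    · refine (ae_restrict_mem measurableSet_Ioc).mono fun r hr => integral_nonneg fun u => ?_
      exact mul_nonneg (hg0 u).le ((hp r hr).curvDet_pos (hf.add_smul hg r) u).le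
  rw [bodyVol, bodyVol, ← h1, measureReal_sdiff hsub (isClosed_bodyOf f).measurableSet
    (volume_bodyOf_lt_top (hf.add_smul hg s).continuous).ne]
  ring

end

end

/-! ### First variation of the volume -/

noncomputable section

open Filter Topology

variable {n : ℕ} {f g h φ ψ χ : USphere n → ℝ}

section

variable [NeZero n]

lemma continuous_homHess_two (hh : IsC2 h) (hψ : IsC2 ψ) (hχ : IsC2 χ) :
    Continuous fun p : (ℝ × ℝ) × USphere n => homHess h (p.2 : Euc n) +
      p.1.1 • homHess ψ (p.2 : Euc n) + p.1.2 • homHess χ (p.2 : Euc n) :=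
  (((continuous_homHess_coe hh).comp continuous_snd).add (continuous_fst.fst.smul
    ((continuous_homHess_coe hψ).comp continuous_snd))).add (continuous_fst.snd.smul
    ((continuous_homHess_coe hχ).comp continuous_snd))

/-- The unit tangent bundle is compact and the quadratic form is jointly continuous in the
parameters and the tangent vector, so positivity is an open condition. -/
lemma HasPosCurv.eventually_add_smul_add_smul (hp : HasPosCurv h) (hh : IsC2 h) (hψ : IsC2 ψ)
    (hχ : IsC2 χ) : ∀ᶠ p : ℝ × ℝ in 𝓝 0, HasPosCurv (h + p.1 • ψ + p.2 • χ) := by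
  let K : Set (USphere n × Euc n) :=
    {q | q.2 ∈ sphere (0 : Euc n) 1 ∧ inner ℝ q.2 (q.1 : Euc n) = 0}
  have hK : IsCompact K := by
    refine (isCompact_univ.prod (isCompact_sphere (0 : Euc n) 1)).of_isClosed_subset ?_
      fun q hq => ⟨mem_univ _, hq.1⟩
    refine (isClosed_sphere.preimage continuous_snd).inter (isClosed_eq ?_ continuous_const)
    fun_prop
  have hev : ∀ᶠ p : ℝ × ℝ in 𝓝 0, ∀ q ∈ K, 0 < inner ℝ ((homHess h (q.1 : Euc n) +
      p.1 • homHess ψ (q.1 : Euc n) + p.2 • homHess χ (q.1 : Euc n)) q.2) q.2 := by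
    refine hK.eventually_forall_of_forall_eventually fun q hq => ?_
    have hcont : Continuous fun z : (ℝ × ℝ) × (USphere n × Euc n) =>
        inner ℝ ((homHess h (z.2.1 : Euc n) + z.1.1 • homHess ψ (z.2.1 : Euc n) +
          z.1.2 • homHess χ (z.2.1 : Euc n)) z.2.2) z.2.2 :=
      (((continuous_homHess_two hh hψ hχ).comp (continuous_fst.prodMk
        continuous_snd.fst)).clm_apply continuous_snd.snd).inner continuous_snd.snd
    refine hcont.continuousAt.eventually_const_lt ?_
    simp only [Prod.fst_zero, Prod.snd_zero]
    rw [zero_smul ℝ (homHess ψ _), zero_smul ℝ (homHess χ _), add_zero, add_zero]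
    refine hp q.1 q.2 ?_ hq.2
    exact ne_zero_of_mem_unit_sphere ⟨q.2, hq.1⟩
  filter_upwards [hev] with p hpp u v hv hvu
  have hA : homHess (h + p.1 • ψ + p.2 • χ) (u : Euc n) = homHess h (u : Euc n) +
      p.1 • homHess ψ (u : Euc n) + p.2 • homHess χ (u : Euc n) := by
    rw [homHess_add_smul (hh.add_smul hψ _) hχ _ u.coe_ne_zero,
      homHess_add_smul hh hψ _ u.coe_ne_zero]
  have hv' : 0 < ‖v‖ := norm_pos_iff.mpr hv
  have h1 := hpp (u, ‖v‖⁻¹ • v) ⟨by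
    rw [mem_sphere_zero_iff_norm, norm_smul, norm_inv, norm_norm, inv_mul_cancel₀ hv'.ne'], by
    simp [inner_smul_left, hvu]⟩
  rw [hA]
  rw [map_smul, inner_smul_left, inner_smul_right] at h1
  have h2 : (0 : ℝ) < ‖v‖⁻¹ := inv_pos.mpr hv'
  exact (pos_iff_pos_of_mul_pos ((mul_pos_iff_of_pos_left h2).mp h1)).mp h2

lemma HasPosCurv.eventually_add_smul (hp : HasPosCurv h) (hh : IsC2 h) (hψ : IsC2 ψ) :
    ∀ᶠ t : ℝ in 𝓝 0, HasPosCurv (h + t • ψ) := by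
  have h1 := hp.eventually_add_smul_add_smul hh hψ hψ
  have h2 : Tendsto (fun t : ℝ => (t, (0 : ℝ))) (𝓝 0) (𝓝 0) :=
    (Continuous.tendsto (by fun_prop) 0 : Tendsto (fun t : ℝ => (t, (0 : ℝ))) (𝓝 0) _)
  simpa using h2.eventually h1

lemma HasPosCurv.smul (hp : HasPosCurv h) (hh : IsC2 h) {r : ℝ} (hr : 0 < r) :
    HasPosCurv ((0 : USphere n → ℝ) + r • h) := by
  have h0 : IsC2 (0 : USphere n → ℝ) := contMDiff_const
  have hz : homExt (0 : USphere n → ℝ) = 0 := by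
    funext x
    by_cases hx : x = 0
    · simp [hx, homExt]
    · simp [homExt_of_ne_zero _ hx]
  have hz1 : homGrad (0 : USphere n → ℝ) = 0 := by
    funext x
    simp [homGrad, hz, gradient]
  have hz2 : ∀ x, homHess (0 : USphere n → ℝ) x = 0 := fun x => by
    simp [homHess, hz1]
  intro u v hv hvu
  rw [homHess_add_smul h0 hh r u.coe_ne_zero, hz2, zero_add, smul_apply, inner_smul_left]
  exact mul_pos hr (hp u v hv hvu)

/-- First variation of the volume. -/
lemma hasDerivAt_bodyVol (hn : 2 ≤ n) (hf : IsC2 f) (hg : IsC2 g) (hg0 : ∀ u, 0 < g u)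
    (hp : HasPosCurv f) :
    HasDerivAt (fun t : ℝ => bodyVol (f + t • g)) (∫ u, g u * curvDet f u ∂(sphereMeasure n)) 0 := by
  obtain ⟨ε, hε, hball⟩ := Metric.eventually_nhds_iff.mp (hp.eventually_add_smul hf hg)
  set δ := ε / 2
  have hδ : 0 < δ := half_pos hε
  have hpos : ∀ t : ℝ, |t| ≤ δ → HasPosCurv (f + t • g) := fun t ht =>
    hball (by rw [Real.dist_eq, sub_zero]; exact ht.trans_lt (half_lt_self hε))
  -- The shell formula only covers nonnegative parameters. Starting from `f - δ g` makes `t = 0` an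
  -- interior point and so gives a two-sided derivative.
  set f₀ := f + (-δ) • g
  have hf₀ : IsC2 f₀ := hf.add_smul hg _
  have hshift : ∀ t : ℝ, f₀ + (δ + t) • g = f + t • g := fun t => by
    simp only [f₀]; module
  set P : ℝ → ℝ := fun r => ∫ u, g u * curvDet (f₀ + r • g) u ∂(sphereMeasure n)
  have hP : Continuous P := continuous_integral_sphere
    (F := fun (r : ℝ) u => g u * curvDet (f₀ + r • g) u)
    ((hg.continuous.comp continuous_snd).mul (continuous_curvDet_add_smul hf₀ hg))
  have h1 : ∀ t : ℝ, |t| ≤ δ → bodyVol (f + t • g) = bodyVol f₀ + ∫ r in 0..(δ + t), P r := by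
    intro t ht
    have ht' := abs_le.mp ht
    rw [← hshift t]
    refine bodyVol_add_smul hn hf₀ hg hg0 (by linarith) fun r hr => ?_
    have h2 : f₀ + r • g = f + (r - δ) • g := by
      rw [← hshift]; congr 2; ring
    rw [h2]
    exact hpos _ (abs_le.mpr ⟨by linarith [hr.1], by linarith [hr.2]⟩)
  have h3 : HasDerivAt (fun t : ℝ => bodyVol f₀ + ∫ r in 0..(δ + t), P r) (P (δ + 0)) 0 := by
    have h4 : HasDerivAt (fun x : ℝ => ∫ r in 0..x, P r) (P (δ + 0)) (δ + 0) :=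
      hP.integral_hasStrictDerivAt 0 _ |>.hasDerivAt
    have h5 : HasDerivAt (fun t : ℝ => δ + t) 1 0 := (hasDerivAt_id (0 : ℝ)).const_add δ
    simpa using (h4.comp (0 : ℝ) h5).const_add (bodyVol f₀)
  have h6 : P (δ + 0) = ∫ u, g u * curvDet f u ∂(sphereMeasure n) := by
    have h7 := hshift 0
    rw [zero_smul, add_zero f] at h7
    simp only [P, h7]
  rw [← h6]
  refine h3.congr_of_eventuallyEq ?_
  filter_upwards [Metric.closedBall_mem_nhds (0 : ℝ) hδ] with t ht
  exact h1 t (by simpa using ht)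

/-- The volume of a body in terms of its support function. -/
lemma bodyVol_eq (hn : 2 ≤ n) (hh : IsC2 h) (h0 : ∀ u, 0 < h u) (hp : HasPosCurv h) :
    bodyVol h = (1 / n) * ∫ u, h u * curvDet h u ∂(sphereMeasure n) := by
  have hz : IsC2 (0 : USphere n → ℝ) := contMDiff_const
  -- The body is swept out from the origin by the dilates `r h`, whose `curvDet` scales as `r ^ (n -
  -- 1)`; integrating over `[0, 1]` produces `1 / n`.
  have h1 := bodyVol_add_smul hn hz hh h0 zero_le_one fun r hr => hp.smul hh hr.1
  have h2 : bodyVol (0 : USphere n → ℝ) = 0 := by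
    have hsub : bodyOf (0 : USphere n → ℝ) ⊆ {0} := by
      intro x hx
      by_contra hx0
      have := hx (unitDir x hx0)
      rw [inner_unitDir x hx0] at this
      exact hx0 (norm_le_zero_iff.mp this)
    have : Nontrivial (Euc n) := nontrivial_Euc
    have h3 : volume (bodyOf (0 : USphere n → ℝ)) = 0 :=
      measure_mono_null hsub (measure_singleton _)
    rw [bodyVol, Measure.real, h3, ENNReal.toReal_zero]
  have h4 : ∀ (r : ℝ) (u : USphere n), curvDet ((0 : USphere n → ℝ) + r • h) u =
      r ^ (n - 1) * curvDet h u := by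
    intro r u
    have h5 : homHess ((0 : USphere n → ℝ) + r • h) (u : Euc n) = r • homHess h (u : Euc n) := by
      have h6 := homHess_add_smul hz hz 1 u.coe_ne_zero
      simp only [smul_zero, add_zero, one_smul, left_eq_add] at h6
      rw [homHess_add_smul hz hh r u.coe_ne_zero, h6, zero_add]
    rw [curvDet, h5, det_smul_homHess_add hh, real_inner_self_eq_norm_sq, u.norm_coe]
    ring
  have hn0 : ((n : ℝ)) ≠ 0 := by positivity
  have h7 : ∀ r : ℝ, ∫ u, h u * curvDet ((0 : USphere n → ℝ) + r • h) u ∂(sphereMeasure n) =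
      r ^ (n - 1) * ∫ u, h u * curvDet h u ∂(sphereMeasure n) := by
    intro r
    rw [← integral_const_mul]
    refine integral_congr_ae (Eventually.of_forall fun u => ?_)
    simp only [h4]
    ring
  simp only [h7] at h1
  rw [intervalIntegral.integral_mul_const, integral_pow, h2, one_smul, zero_add, zero_add] at h1
  rw [h1, Nat.sub_add_cancel NeZero.one_le]
  have h8 : ((n - 1 : ℕ) : ℝ) + 1 = n := by
    rw [Nat.cast_sub NeZero.one_le]; simp
  rw [h8]
  simp [NeZero.ne n]

end

/-! ### The linearized curvature determinant -/

section Mixed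

/-- The determinant of operators is a smooth function. -/
lemma contDiff_clm_det : ContDiff ℝ 2 fun M : Euc n →L[ℝ] Euc n => M.det := by
  let b := (EuclideanSpace.basisFun (Fin n) ℝ).toBasis
  have h1 : (fun M : Euc n →L[ℝ] Euc n => M.det) = fun M : Euc n →L[ℝ] Euc n =>
      ∑ σ : Equiv.Perm (Fin n), Equiv.Perm.sign σ •
        ∏ i, (LinearMap.toMatrix b b (M : Euc n →ₗ[ℝ] Euc n)) (σ i) i := by
    funext M
    have h2 : M.det = LinearMap.det (M : Euc n →ₗ[ℝ] Euc n) := rfl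
    rw [h2, ← LinearMap.det_toMatrix b, Matrix.det_apply]
  rw [h1]
  refine ContDiff.sum fun σ _ => ContDiff.const_smul _ (contDiff_prod fun i _ => ?_)
  have h3 : (fun M : Euc n →L[ℝ] Euc n =>
      (LinearMap.toMatrix b b (M : Euc n →ₗ[ℝ] Euc n)) (σ i) i) =
      fun M => (M (b i)) (σ i) := by
    funext M
    simp [LinearMap.toMatrix_apply, b]
  rw [h3]
  exact (EuclideanSpace.proj (𝕜 := ℝ) (σ i)).contDiff.comp
    (ContinuousLinearMap.apply ℝ (Euc n) (b i)).contDiff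

/-- The derivative of `curvDet` at `h` in the direction `ψ`. -/
def mixDet (h ψ : USphere n → ℝ) (u : USphere n) : ℝ :=
  fderiv ℝ (fun M : Euc n →L[ℝ] Euc n => M.det)
    (homHess h (u : Euc n) + (innerSL ℝ (u : Euc n)).smulRight (u : Euc n))
    (homHess ψ (u : Euc n))

variable [NeZero n]

lemma hasDerivAt_curvDet (hh : IsC2 h) (hψ : IsC2 ψ) (u : USphere n) (t : ℝ) :
    HasDerivAt (fun s : ℝ => curvDet (h + s • ψ) u) (mixDet (h + t • ψ) ψ u) t := by
  have h1 : (fun s : ℝ => curvDet (h + s • ψ) u) = fun s : ℝ =>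
      (homHess h (u : Euc n) + s • homHess ψ (u : Euc n) +
        (innerSL ℝ (u : Euc n)).smulRight (u : Euc n)).det := by
    funext s
    rw [curvDet, homHess_add_smul hh hψ s u.coe_ne_zero]
  have h2 : HasDerivAt (fun s : ℝ => homHess h (u : Euc n) + s • homHess ψ (u : Euc n) +
      (innerSL ℝ (u : Euc n)).smulRight (u : Euc n)) (homHess ψ (u : Euc n)) t := by
    simpa using (((hasDerivAt_id t).smul_const (homHess ψ (u : Euc n))).const_add
      (homHess h (u : Euc n))).add_const ((innerSL ℝ (u : Euc n)).smulRight (u : Euc n))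
  have h3 := ((contDiff_clm_det (n := n)).differentiable (by norm_num)
    (homHess h (u : Euc n) + t • homHess ψ (u : Euc n) +
      (innerSL ℝ (u : Euc n)).smulRight (u : Euc n))).hasFDerivAt.comp_hasDerivAt t h2
  rw [h1, mixDet, homHess_add_smul hh hψ t u.coe_ne_zero]
  exact h3

lemma continuous_curvDet_two (hh : IsC2 h) (hψ : IsC2 ψ) (hχ : IsC2 χ) :
    Continuous fun p : (ℝ × ℝ) × USphere n => curvDet (h + p.1.1 • ψ + p.1.2 • χ) p.2 := by
  have h1 : (fun p : (ℝ × ℝ) × USphere n => curvDet (h + p.1.1 • ψ + p.1.2 • χ) p.2) =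
      fun p => (homHess h (p.2 : Euc n) + p.1.1 • homHess ψ (p.2 : Euc n) +
        p.1.2 • homHess χ (p.2 : Euc n) +
          (innerSL ℝ (p.2 : Euc n)).smulRight (p.2 : Euc n)).det := by
    funext p
    rw [curvDet, homHess_add_smul (hh.add_smul hψ _) hχ _ p.2.coe_ne_zero,
      homHess_add_smul hh hψ _ p.2.coe_ne_zero]
  rw [h1]
  exact ContinuousLinearMap.continuous_det.comp
    ((continuous_homHess_two hh hψ hχ).add (continuous_rankOne.comp continuous_snd))

lemma continuous_mixDet_two (hh : IsC2 h) (hψ : IsC2 ψ) (hχ : IsC2 χ) (hφ : IsC2 φ) :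
    Continuous fun p : (ℝ × ℝ) × USphere n => mixDet (h + p.1.1 • ψ + p.1.2 • χ) φ p.2 := by
  have h1 : (fun p : (ℝ × ℝ) × USphere n => mixDet (h + p.1.1 • ψ + p.1.2 • χ) φ p.2) =
      fun p => fderiv ℝ (fun M : Euc n →L[ℝ] Euc n => M.det)
        (homHess h (p.2 : Euc n) + p.1.1 • homHess ψ (p.2 : Euc n) +
          p.1.2 • homHess χ (p.2 : Euc n) +
          (innerSL ℝ (p.2 : Euc n)).smulRight (p.2 : Euc n)) (homHess φ (p.2 : Euc n)) := by
    funext p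
    rw [mixDet, homHess_add_smul (hh.add_smul hψ _) hχ _ p.2.coe_ne_zero,
      homHess_add_smul hh hψ _ p.2.coe_ne_zero]
  rw [h1]
  have hc4 := continuous_homHess_coe hφ
  have hd : Continuous (fderiv ℝ (fun M : Euc n →L[ℝ] Euc n => M.det)) :=
    (contDiff_clm_det (n := n)).continuous_fderiv (by norm_num)
  exact (hd.comp ((continuous_homHess_two hh hψ hχ).add
    (continuous_rankOne.comp continuous_snd))).clm_apply (hc4.comp continuous_snd)

lemma continuous_mixDet (hh : IsC2 h) (hφ : IsC2 φ) : Continuous (mixDet h φ) := by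
  have h1 := (continuous_mixDet_two hh hh hh hφ).comp
    (continuous_const.prodMk continuous_id : Continuous fun u : USphere n => (((0 : ℝ), (0 : ℝ)), u))
  simpa [Function.comp_def] using h1

omit [NeZero n] in
lemma hasDerivAt_integral_sphere {F F' : ℝ → USphere n → ℝ} (hF : Continuous F.uncurry)
    (hF' : Continuous F'.uncurry) (hd : ∀ t u, HasDerivAt (fun s => F s u) (F' t u) t) (t : ℝ) :
    HasDerivAt (fun s => ∫ u, F s u ∂(sphereMeasure n)) (∫ u, F' t u ∂(sphereMeasure n)) t := by
  obtain ⟨C, hC⟩ := ((isCompact_closedBall t 1).prod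
    (isCompact_univ (X := USphere n))).exists_bound_of_continuousOn hF'.continuousOn
  have hc : ∀ {G : ℝ → USphere n → ℝ}, Continuous G.uncurry → ∀ s, Continuous (G s) :=
    fun hG s => hG.comp (continuous_const.prodMk continuous_id)
  refine (hasDerivAt_integral_of_dominated_loc_of_deriv_le (F' := F') (bound := fun _ => C)
    (Metric.closedBall_mem_nhds t one_pos)
    (Eventually.of_forall fun s => (hc hF s).aestronglyMeasurable) (integrable_sphere (hc hF t))
    (hc hF' t).aestronglyMeasurable (Eventually.of_forall fun u s hs => ?_)
    (integrable_const C) (Eventually.of_forall fun u s _ => hd s u)).2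
  exact hC (s, u) ⟨hs, mem_univ _⟩

/-- Symmetry of mixed second derivatives in terms of partial derivatives. -/
lemma mixed_partials_eq {M p q p₁ p₂ q₁ q₂ : ℝ → ℝ → ℝ}
    (hMp : ∀ᶠ z : ℝ × ℝ in 𝓝 0, HasDerivAt (fun a => M a z.2) (p z.1 z.2) z.1)
    (hMq : ∀ᶠ z : ℝ × ℝ in 𝓝 0, HasDerivAt (fun b => M z.1 b) (q z.1 z.2) z.2)
    (hp₁ : ∀ a b, HasDerivAt (fun a => p a b) (p₁ a b) a)
    (hp₂ : ∀ a b, HasDerivAt (fun b => p a b) (p₂ a b) b)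
    (hq₁ : ∀ a b, HasDerivAt (fun a => q a b) (q₁ a b) a)
    (hq₂ : ∀ a b, HasDerivAt (fun b => q a b) (q₂ a b) b)
    (cp : Continuous p.uncurry) (cq : Continuous q.uncurry)
    (cp₁ : Continuous p₁.uncurry) (cp₂ : Continuous p₂.uncurry)
    (cq₁ : Continuous q₁.uncurry) (cq₂ : Continuous q₂.uncurry) : p₂ 0 0 = q₁ 0 0 := by
  let S : ℝ →L[ℝ] (ℝ →L[ℝ] ℝ) := ContinuousLinearMap.toSpanSingletonCLE (𝕜 := ℝ) (E := ℝ)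
  -- Continuous partial derivatives give a total derivative. Used for `M` near the origin and for
  -- `p` and `q` at the origin, this makes `M` twice differentiable there.
  have key : ∀ {G G₁ G₂ : ℝ → ℝ → ℝ} {z : ℝ × ℝ},
      (∀ᶠ w in 𝓝 z, HasDerivAt (fun a => G a w.2) (G₁ w.1 w.2) w.1) →
      (∀ᶠ w in 𝓝 z, HasDerivAt (fun b => G w.1 b) (G₂ w.1 w.2) w.2) →
      Continuous G₁.uncurry → Continuous G₂.uncurry →
      HasFDerivAt (fun w : ℝ × ℝ => G w.1 w.2)
        ((G₁ z.1 z.2) • ContinuousLinearMap.fst ℝ ℝ ℝ +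
          (G₂ z.1 z.2) • ContinuousLinearMap.snd ℝ ℝ ℝ) z := by
    intro G G₁ G₂ z h1 h2 c1 c2
    have h3 := (hasStrictFDerivAt_uncurry_coprod (𝕜 := ℝ) (u := z) (f := G)
      (f₁ := fun a b => S (G₁ a b)) (f₂ := fun a b => S (G₂ a b))
      (h1.mono fun w hw => hw.hasFDerivAt) (h2.mono fun w hw => hw.hasFDerivAt)
      (S.continuous.comp c1).continuousAt (S.continuous.comp c2).continuousAt).hasFDerivAt
    refine h3.congr_fderiv ?_
    ext <;> simp [S, Function.HasUncurry.uncurry]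
  have hM : ∀ᶠ z : ℝ × ℝ in 𝓝 0, HasFDerivAt (fun w : ℝ × ℝ => M w.1 w.2)
      ((p z.1 z.2) • ContinuousLinearMap.fst ℝ ℝ ℝ +
        (q z.1 z.2) • ContinuousLinearMap.snd ℝ ℝ ℝ) z := by
    filter_upwards [hMp.eventually_nhds, hMq.eventually_nhds] with z h1 h2
    exact key h1 h2 cp cq
  have hp := key (z := 0) (Eventually.of_forall fun w => hp₁ w.1 w.2)
    (Eventually.of_forall fun w => hp₂ w.1 w.2) cp₁ cp₂
  have hq := key (z := 0) (Eventually.of_forall fun w => hq₁ w.1 w.2)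
    (Eventually.of_forall fun w => hq₂ w.1 w.2) cq₁ cq₂
  have hsecond := (hp.smul_const (ContinuousLinearMap.fst ℝ ℝ ℝ)).add
    (hq.smul_const (ContinuousLinearMap.snd ℝ ℝ ℝ))
  have hsym := second_derivative_symmetric_of_eventually hM hsecond (0, 1) (1, 0)
  simpa using hsym

end Mixed

end

/-! ### Self-adjointness of the linearization -/

noncomputable section

open Filter Topology

variable {n : ℕ} {f g h φ ψ χ : USphere n → ℝ}

section Mixed

variable [NeZero n]

lemma continuous_integral_mul_curvDet (hh : IsC2 h) (hψ : IsC2 ψ) (hχ : IsC2 χ) (hφ : IsC2 φ) :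
    Continuous fun z : ℝ × ℝ =>
      ∫ u, φ u * curvDet (h + z.1 • ψ + z.2 • χ) u ∂(sphereMeasure n) :=
  continuous_integral_sphere (F := fun (z : ℝ × ℝ) u => φ u * curvDet (h + z.1 • ψ + z.2 • χ) u)
    ((hφ.continuous.comp continuous_snd).mul (continuous_curvDet_two hh hψ hχ))

lemma continuous_integral_mul_mixDet {ρ : USphere n → ℝ} (hh : IsC2 h) (hψ : IsC2 ψ)
    (hχ : IsC2 χ) (hφ : IsC2 φ) (hρ : IsC2 ρ) :
    Continuous fun z : ℝ × ℝ =>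
      ∫ u, φ u * mixDet (h + z.1 • ψ + z.2 • χ) ρ u ∂(sphereMeasure n) :=
  continuous_integral_sphere (F := fun (z : ℝ × ℝ) u => φ u * mixDet (h + z.1 • ψ + z.2 • χ) ρ u)
    ((hφ.continuous.comp continuous_snd).mul (continuous_mixDet_two hh hψ hχ hρ))

lemma hasDerivAt_integral_mul_curvDet (hh : IsC2 h) (hψ : IsC2 ψ) (hφ : IsC2 φ) (t : ℝ) :
    HasDerivAt (fun s : ℝ => ∫ u, φ u * curvDet (h + s • ψ) u ∂(sphereMeasure n))
      (∫ u, φ u * mixDet (h + t • ψ) ψ u ∂(sphereMeasure n)) t := by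
  have e : Continuous fun p : ℝ × USphere n => (((0 : ℝ), p.1), p.2) := by fun_prop
  have h1 := (continuous_mixDet_two hh hψ hψ hψ).comp e
  refine hasDerivAt_integral_sphere
    (F := fun b u => φ u * curvDet (h + b • ψ) u)
    (F' := fun b u => φ u * mixDet (h + b • ψ) ψ u)
    ((hφ.continuous.comp continuous_snd).mul (continuous_curvDet_add_smul hh hψ))
    ((hφ.continuous.comp continuous_snd).mul ?_)
    (fun t u => (hasDerivAt_curvDet hh hψ u t).const_mul _) t
  simpa [Function.comp_def] using h1

lemma HasPosCurv.hasDerivAt_bodyVol (hn : 2 ≤ n) {t : ℝ} (hp : HasPosCurv (h + t • ψ))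
    (hh : IsC2 h) (hψ : IsC2 ψ) (hψ0 : ∀ u, 0 < ψ u) :
    HasDerivAt (fun s : ℝ => bodyVol (h + s • ψ))
      (∫ u, ψ u * curvDet (h + t • ψ) u ∂(sphereMeasure n)) t := by
  have h1 := _root_.hasDerivAt_bodyVol hn (hh.add_smul hψ t) hψ hψ0 hp
  have h2 : (fun s : ℝ => bodyVol (h + s • ψ)) =
      fun s => (fun s : ℝ => bodyVol (h + t • ψ + s • ψ)) (s - t) := by
    funext s
    congr 1
    module
  rw [h2]
  rw [← sub_self t] at h1
  exact h1.comp_sub_const t t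

/-- The linearization of `curvDet` is formally self-adjoint. -/
lemma integral_mul_mixDet_comm (hn : 2 ≤ n) (hh : IsC2 h) (hp : HasPosCurv h) (hψ : IsC2 ψ)
    (hχ : IsC2 χ) (hψ0 : ∀ u, 0 < ψ u) (hχ0 : ∀ u, 0 < χ u) :
    ∫ u, ψ u * mixDet h χ u ∂(sphereMeasure n) = ∫ u, χ u * mixDet h ψ u ∂(sphereMeasure n) := by
  have hswap : ∀ a b : ℝ, h + a • ψ + b • χ = h + b • χ + a • ψ := fun a b => by module
  have hev := hp.eventually_add_smul_add_smul hh hψ hχ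
  have ha : ∀ {ρ : USphere n → ℝ}, IsC2 ρ → ∀ a b : ℝ, HasDerivAt
      (fun a : ℝ => ∫ u, ρ u * curvDet (h + a • ψ + b • χ) u ∂(sphereMeasure n))
      (∫ u, ρ u * mixDet (h + a • ψ + b • χ) ψ u ∂(sphereMeasure n)) a := by
    intro ρ hρ a b
    simp only [hswap _ b]
    exact hasDerivAt_integral_mul_curvDet (hh.add_smul hχ b) hψ hρ a
  have hb : ∀ {ρ : USphere n → ℝ}, IsC2 ρ → ∀ a b : ℝ, HasDerivAt
      (fun b : ℝ => ∫ u, ρ u * curvDet (h + a • ψ + b • χ) u ∂(sphereMeasure n))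
      (∫ u, ρ u * mixDet (h + a • ψ + b • χ) χ u ∂(sphereMeasure n)) b := fun hρ a b =>
    hasDerivAt_integral_mul_curvDet (hh.add_smul hψ a) hχ hρ b
  -- Both sides are mixed second derivatives at the origin of the volume of `h + a ψ + b χ`.
  -- Positivity of `ψ` and `χ` enters through the first variation formula.
  have := mixed_partials_eq (M := fun a b => bodyVol (h + a • ψ + b • χ))
    (p := fun a b => ∫ u, ψ u * curvDet (h + a • ψ + b • χ) u ∂(sphereMeasure n))
    (q := fun a b => ∫ u, χ u * curvDet (h + a • ψ + b • χ) u ∂(sphereMeasure n))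
    (by
      filter_upwards [hev] with z hz
      simp only [hswap _ z.2] at hz ⊢
      exact hz.hasDerivAt_bodyVol hn (hh.add_smul hχ _) hψ hψ0)
    (by
      filter_upwards [hev] with z hz
      exact hz.hasDerivAt_bodyVol hn (hh.add_smul hψ _) hχ hχ0)
    (ha hψ) (hb hψ) (ha hχ) (hb hχ) 
    (continuous_integral_mul_curvDet hh hψ hχ hψ) (continuous_integral_mul_curvDet hh hψ hχ hχ)
    (continuous_integral_mul_mixDet hh hψ hχ hψ hψ) (continuous_integral_mul_mixDet hh hψ hχ hψ hχ)
    (continuous_integral_mul_mixDet hh hψ hχ hχ hψ) (continuous_integral_mul_mixDet hh hψ hχ hχ hχ)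
  simpa using this

end Mixed

end

/-! ### The curvature matrix in a frame -/

noncomputable section

open Filter Topology

variable {n : ℕ} {f g h φ ψ χ : USphere n → ℝ}

section Frame

lemma SphereFrame.inner_coe (e : SphereFrame n) (u : USphere n) (i : Fin (n - 1)) :
    inner ℝ (u : Euc n) (e u i : Euc n) = 0 :=
  Submodule.mem_orthogonal_singleton_iff_inner_right.mp (e u i).2

lemma SphereFrame.inner_apply (e : SphereFrame n) (u : USphere n) (i j : Fin (n - 1)) :
    inner ℝ (e u i : Euc n) (e u j : Euc n) = if i = j then 1 else 0 := by
  simpa using orthonormal_iff_ite.mp (e u).orthonormal i j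

lemma curvMatrix_one (e : SphereFrame n) (u : USphere n) :
    curvMatrix e (1 : USphere n → ℝ) u = 1 := by
  have h1 : fderiv ℝ (radialExt (1 : USphere n → ℝ)) =ᶠ[𝓝 (u : Euc n)] fun _ => 0 := by
    filter_upwards [isOpen_ne.mem_nhds u.coe_ne_zero] with x hx
    have h2 : radialExt (1 : USphere n → ℝ) =ᶠ[𝓝 x] fun _ => 1 := by
      filter_upwards [isOpen_ne.mem_nhds hx] with y hy
      rw [radialExt_of_ne_zero _ hy]; rfl
    rw [h2.fderiv_eq, fderiv_const_apply]
  have h3 : sphHess e (1 : USphere n → ℝ) u = 0 := by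
    ext i j
    simp [sphHess, h1.fderiv_eq]
  rw [curvMatrix, h3, zero_add, Pi.one_apply, one_smul]

variable [NeZero n]

lemma IsC2.mul (hf : IsC2 f) (hg : IsC2 g) : IsC2 (f * g) := ContMDiff.smul hf hg

lemma IsC2.one : IsC2 (1 : USphere n → ℝ) := contMDiff_const

lemma IsC2.inv (hf : IsC2 f) (h0 : ∀ u, f u ≠ 0) : IsC2 f⁻¹ := by
  intro u
  have h1 : ContDiffAt ℝ 2 (fun t : ℝ => t⁻¹) (f u) := contDiffAt_inv ℝ (h0 u)
  exact h1.contMDiffAt.comp u (hf u)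

/-- Product rule for `|x|` times the radial extension: at a unit vector the derivative of the norm
vanishes on tangent vectors, and its second derivative is the inner product on them. Thus `Q` is the
tangential block of the Hessian of the homogeneous extension. -/
lemma fderiv_fderiv_homExt (hψ : IsC2 ψ) (u : USphere n) {v w : Euc n}
    (hv : inner ℝ (u : Euc n) v = 0) (hw : inner ℝ (u : Euc n) w = 0) :
    fderiv ℝ (fderiv ℝ (homExt ψ)) (u : Euc n) v w =
      fderiv ℝ (fderiv ℝ (radialExt ψ)) (u : Euc n) v w + ψ u * inner ℝ v w := by
  have hu := u.coe_ne_zero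
  have hr : ∀ {x : Euc n}, x ≠ 0 → HasFDerivAt (radialExt ψ) (fderiv ℝ (radialExt ψ) x) x :=
    fun hx => ((hψ.contDiffAt_radialExt hx).differentiableAt (by norm_num)).hasFDerivAt
  have h1 : (fun x => fderiv ℝ (homExt ψ) x w) =ᶠ[𝓝 (u : Euc n)] fun x =>
      ‖x‖ * fderiv ℝ (radialExt ψ) x w + radialExt ψ x * (‖x‖⁻¹ * inner ℝ x w) := by
    filter_upwards [isOpen_ne.mem_nhds hu] with x hx
    have h2 : HasFDerivAt (homExt ψ) _ x := (hasFDerivAt_norm_of_ne_zero hx).mul (hr hx)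
    rw [h2.fderiv]
    simp
  have hd2 : DifferentiableAt ℝ (fderiv ℝ (homExt ψ)) (u : Euc n) :=
    ((hψ.contDiffAt_homExt hu).fderiv_right (m := 1) (by norm_num)).differentiableAt (by norm_num)
  have hd3 : DifferentiableAt ℝ (fderiv ℝ (radialExt ψ)) (u : Euc n) :=
    ((hψ.contDiffAt_radialExt hu).fderiv_right (m := 1) (by norm_num)).differentiableAt
      (by norm_num)
  have h3 : HasFDerivAt (fun x => fderiv ℝ (homExt ψ) x w)
      ((fderiv ℝ (fderiv ℝ (homExt ψ)) (u : Euc n)).flip w) (u : Euc n) := by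
    simpa using hd2.hasFDerivAt.clm_apply (hasFDerivAt_const w (u : Euc n))
  have h4 : HasFDerivAt (fun x => fderiv ℝ (radialExt ψ) x w)
      ((fderiv ℝ (fderiv ℝ (radialExt ψ)) (u : Euc n)).flip w) (u : Euc n) := by
    simpa using hd3.hasFDerivAt.clm_apply (hasFDerivAt_const w (u : Euc n))
  have hN := hasFDerivAt_norm_of_ne_zero hu
  have hNi : HasFDerivAt (fun x : Euc n => ‖x‖⁻¹) (fderiv ℝ (fun x : Euc n => ‖x‖⁻¹) (u : Euc n))
      (u : Euc n) :=
    (hN.differentiableAt.inv (norm_ne_zero_iff.mpr hu)).hasFDerivAt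
  have hin : HasFDerivAt (fun x : Euc n => inner ℝ x w) (innerSL ℝ w) (u : Euc n) := by
    refine (innerSL ℝ w).hasFDerivAt.congr_of_eventuallyEq (Eventually.of_forall fun x => ?_)
    simp [real_inner_comm]
  have h5 := (hN.mul h4).add ((hr hu).mul (hNi.mul hin))
  have h6 := congrArg (fun L => L v) (h3.unique (h5.congr_of_eventuallyEq h1))
  have hru : radialExt ψ (u : Euc n) = ψ u := by rw [radialExt_of_ne_zero ψ hu, unitDir_coe]
  have hw' : inner ℝ w (u : Euc n) = 0 := by rw [real_inner_comm]; exact hw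
  simpa [hv, hw, hw', hru, real_inner_comm, u.norm_coe] using h6

lemma curvMatrix_apply (hψ : IsC2 ψ) (e : SphereFrame n) (u : USphere n) (i j : Fin (n - 1)) :
    curvMatrix e ψ u i j =
      inner ℝ (e u i : Euc n) (homHess ψ (u : Euc n) (e u j : Euc n)) := by
  rw [← homHess_symm hψ u.coe_ne_zero, inner_homHess_apply hψ u.coe_ne_zero,
    fderiv_fderiv_homExt hψ u (e.inner_coe u i) (e.inner_coe u j), e.inner_apply]
  simp [curvMatrix, sphHess, Matrix.one_apply]

lemma curvMatrix_eq_of (hψ : IsC2 ψ) (e : SphereFrame n) (u : USphere n) :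
    curvMatrix e ψ u = Matrix.of fun i j =>
      inner ℝ (e u i : Euc n) (homHess ψ (u : Euc n) (e u j : Euc n)) := by
  ext i j
  exact curvMatrix_apply hψ e u i j

lemma curvDet_eq_det_curvMatrix (hψ : IsC2 ψ) (e : SphereFrame n) (u : USphere n) :
    curvDet ψ u = (curvMatrix e ψ u).det := by
  rw [curvDet_eq_det hψ e, curvMatrix_eq_of hψ]

lemma curvMatrix_add_smul (hf : IsC2 f) (hg : IsC2 g) (e : SphereFrame n) (t : ℝ)
    (u : USphere n) : curvMatrix e (f + t • g) u = curvMatrix e f u + t • curvMatrix e g u := by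
  ext i j
  simp only [Matrix.add_apply, Matrix.smul_apply, curvMatrix_apply (hf.add_smul hg t),
    curvMatrix_apply hf, curvMatrix_apply hg, homHess_add_smul hf hg t u.coe_ne_zero]
  simp [inner_add_right, inner_smul_right]

/-- The Hessian of `ψ²` is `2ψ` times that of `ψ` plus `2 ∇ψ ⊗ ∇ψ`. Replacing Hessians by `Q` shifts
the identity term by `ψ² - 2ψ² = -ψ²`. -/
lemma curvMatrix_mul_self (hψ : IsC2 ψ) (e : SphereFrame n) (u : USphere n) :
    curvMatrix e (ψ * ψ) u = (2 * ψ u) • curvMatrix e ψ u +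
      (2 : ℝ) • Matrix.vecMulVec (sphGrad e ψ u) (sphGrad e ψ u) -
        (ψ u ^ 2) • (1 : Matrix (Fin (n - 1)) (Fin (n - 1)) ℝ) := by
  have hu := u.coe_ne_zero
  have hr : ∀ {x : Euc n}, x ≠ 0 → HasFDerivAt (radialExt ψ) (fderiv ℝ (radialExt ψ) x) x :=
    fun hx => ((hψ.contDiffAt_radialExt hx).differentiableAt (by norm_num)).hasFDerivAt
  have hmul : radialExt (ψ * ψ) = fun x => radialExt ψ x * radialExt ψ x := by
    funext x
    by_cases hx : x = 0
    · simp [hx, radialExt]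
    · simp [radialExt_of_ne_zero _ hx]
  have h1 : fderiv ℝ (radialExt (ψ * ψ)) =ᶠ[𝓝 (u : Euc n)] fun x =>
      (2 * radialExt ψ x) • fderiv ℝ (radialExt ψ) x := by
    filter_upwards [isOpen_ne.mem_nhds hu] with x hx
    have h2 : HasFDerivAt (fun x => radialExt ψ x * radialExt ψ x) _ x := (hr hx).mul (hr hx)
    rw [hmul, h2.fderiv, ← two_smul ℝ, smul_smul]
  have hd3 : DifferentiableAt ℝ (fderiv ℝ (radialExt ψ)) (u : Euc n) :=
    ((hψ.contDiffAt_radialExt hu).fderiv_right (m := 1) (by norm_num)).differentiableAt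
      (by norm_num)
  have h2 : HasFDerivAt (fun x => (2 * radialExt ψ x) • fderiv ℝ (radialExt ψ) x) _ (u : Euc n) :=
    ((hr hu).const_mul 2).smul hd3.hasFDerivAt
  have hru : radialExt ψ (u : Euc n) = ψ u := by rw [radialExt_of_ne_zero ψ hu, unitDir_coe]
  ext i j
  simp only [curvMatrix, sphHess, sphGrad, h1.fderiv_eq, h2.fderiv, hru, Matrix.add_apply,
    Matrix.sub_apply, Matrix.smul_apply, Matrix.of_apply, Matrix.vecMulVec_apply, Pi.mul_apply]
  simp
  ring

lemma hasPosCurv_of_posDef (hψ : IsC2 ψ) (e : SphereFrame n)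
    (hpos : ∀ u, (curvMatrix e ψ u).PosDef) : HasPosCurv ψ := by
  intro u v hv hvu
  have hmem : v ∈ (ℝ ∙ (u : Euc n))ᗮ := by
    rw [Submodule.mem_orthogonal_singleton_iff_inner_right, real_inner_comm]
    exact hvu
  set x : Fin (n - 1) → ℝ := fun i => (e u).repr ⟨v, hmem⟩ i
  have hsum : v = ∑ i, x i • (e u i : Euc n) := by
    have := congrArg Subtype.val ((e u).sum_repr ⟨v, hmem⟩)
    simpa [x] using this.symm
  have hx : x ≠ 0 := by
    intro h0
    rw [hsum] at hv
    exact hv (Finset.sum_eq_zero fun i _ => by rw [h0]; simp)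
  refine lt_of_lt_of_eq ((hpos u).dotProduct_mulVec_pos hx) ?_
  rw [real_inner_comm, curvMatrix_eq_of hψ]
  clear_value x
  subst hsum
  simp only [map_sum, map_smul, sum_inner, inner_sum, inner_smul_left, inner_smul_right,
    dotProduct, Matrix.mulVec, Matrix.of_apply, Finset.mul_sum, star_trivial, RCLike.conj_to_real]
  refine Finset.sum_congr rfl fun i _ => Finset.sum_congr rfl fun j _ => ?_
  rw [← homHess_symm hψ u.coe_ne_zero (e u i), real_inner_comm]
  ring

lemma hasDerivAt_det_one_add_smul {ι : Type*} [Fintype ι] [DecidableEq ι] (M : Matrix ι ι ℝ) :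
    HasDerivAt (fun t : ℝ => (1 + t • M).det) M.trace 0 := by
  have h0 : (fun t : ℝ => (1 + t • M).det) = fun t => _ :=
    funext fun t => Matrix.det_one_add_smul t M
  rw [h0]
  set p := (Matrix.det (1 + (Polynomial.X : Polynomial ℝ) • M.map Polynomial.C)).divX.divX
  have h1 := ((hasDerivAt_id (0 : ℝ)).const_mul M.trace).const_add 1
  have h2 := (p.hasDerivAt (0 : ℝ)).mul (hasDerivAt_pow 2 (0 : ℝ))
  exact (h1.add h2).congr_deriv (by simp)

/-- Jacobi's formula: factor `Q(h)` out of `Q(h) + s Q(ψ)` and differentiate `det (1 + s M)` at `0`.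
-/
lemma mixDet_eq (hh : IsC2 h) (hψ : IsC2 ψ) (e : SphereFrame n) (u : USphere n)
    (hpos : (curvMatrix e h u).PosDef) :
    mixDet h ψ u = (curvMatrix e h u).det * ((curvMatrix e h u)⁻¹ * curvMatrix e ψ u).trace := by
  have h1 := hasDerivAt_curvDet hh hψ u 0
  rw [zero_smul, add_zero h] at h1
  have h2 : (fun s : ℝ => curvDet (h + s • ψ) u) = fun s : ℝ => (curvMatrix e h u).det *
      (1 + s • ((curvMatrix e h u)⁻¹ * curvMatrix e ψ u)).det := by
    funext s
    rw [curvDet_eq_det_curvMatrix (hh.add_smul hψ s) e, curvMatrix_add_smul hh hψ, ← Matrix.det_mul,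
      Matrix.mul_add, Matrix.mul_one, Matrix.mul_smul, Matrix.mul_nonsing_inv_cancel_left]
    exact hpos.det_pos.ne'.isUnit
  rw [h2] at h1
  exact h1.unique ((hasDerivAt_det_one_add_smul _).const_mul _)

lemma mixDet_one (hh : IsC2 h) (e : SphereFrame n) (u : USphere n)
    (hpos : (curvMatrix e h u).PosDef) :
    mixDet h 1 u = (curvMatrix e h u).det * (curvMatrix e h u)⁻¹.trace := by
  rw [mixDet_eq hh IsC2.one e u hpos, curvMatrix_one, Matrix.mul_one]

/-- The gradient form appears as the failure of the linear operator `mixDet h` to act as a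
derivation on `ψ * ψ`, up to the zeroth-order term. -/
lemma mixDet_mul_self (hh : IsC2 h) (hψ : IsC2 ψ) (e : SphereFrame n) (u : USphere n)
    (hpos : (curvMatrix e h u).PosDef) :
    mixDet h (ψ * ψ) u = 2 * (ψ u * mixDet h ψ u) + 2 * ((curvMatrix e h u).det *
      ((curvMatrix e h u)⁻¹.mulVec (sphGrad e ψ u) ⬝ᵥ sphGrad e ψ u)) -
        ψ u ^ 2 * mixDet h 1 u := by
  rw [mixDet_eq hh (hψ.mul hψ) e u hpos, mixDet_eq hh hψ e u hpos, mixDet_one hh e u hpos,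
    curvMatrix_mul_self hψ, Matrix.mul_sub, Matrix.mul_add, Matrix.trace_sub, Matrix.trace_add,
    Matrix.mul_smul, Matrix.mul_smul, Matrix.mul_smul, Matrix.trace_smul, Matrix.trace_smul,
    Matrix.trace_smul, Matrix.mul_vecMulVec, Matrix.trace_vecMulVec, Matrix.mul_one]
  simp only [smul_eq_mul]
  ring

end Frame

end

/-! ### Second variation of the log-Brunn–Minkowski inequality -/

noncomputable section

open Filter Topology

variable {n : ℕ} {f g h φ ψ χ : USphere n → ℝ}

/-- The necessary second order condition at a local minimum. -/
lemma second_deriv_nonneg_of_isLocalMin {k k' : ℝ → ℝ} {c x : ℝ} (hmin : IsLocalMin k x)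
    (hd : ∀ᶠ s in 𝓝 x, HasDerivAt k (k' s) s) (hd2 : HasDerivAt k' c x) : 0 ≤ c := by
  by_contra hc
  have hk : deriv k =ᶠ[𝓝 x] k' := hd.mono fun s hs => hs.deriv
  have h2 : deriv (deriv k) x = c := by rw [hk.deriv_eq, hd2.deriv]
  -- A negative second derivative would make `x` a local maximum as well, so `k` would be locally
  -- constant and the second derivative zero.
  have hmax : IsLocalMax k x := isLocalMax_of_deriv_deriv_neg (by rw [h2]; exact not_le.mp hc)
    hmin.deriv_eq_zero hd.self_of_nhds.continuousAt
  have hconst : k =ᶠ[𝓝 x] fun _ => k x := by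
    filter_upwards [hmin, hmax] with s h3 h4
    exact le_antisymm h4 h3
  have h3 : deriv k =ᶠ[𝓝 x] fun _ => 0 := by
    filter_upwards [hconst.eventuallyEq_nhds] with s hs
    rw [hs.deriv_eq, deriv_const]
  rw [h3.deriv_eq, deriv_const] at h2
  exact hc h2.le

lemma IsEvenFn.add_smul (hf : IsEvenFn f) (hg : IsEvenFn g) (t : ℝ) : IsEvenFn (f + t • g) := by
  intro u
  simp [hf u, hg u]

variable [NeZero n]

/-- The log-Brunn-Minkowski inequality for the midpoint of two bodies, with a majorant of the
geometric mean of the support functions. -/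
lemma LogBrunnMinkowski.bodyVol_mul_le (hLBM : LogBrunnMinkowski n) (hn : 2 ≤ n)
    (hf : IsC2 f) (hfe : IsEvenFn f) (hfp : HasPosCurv f) (hg : IsC2 g) (hge : IsEvenFn g)
    (hgp : HasPosCurv g) (hφ : Continuous φ) (hle : ∀ u, f u * g u ≤ φ u ^ 2)
    (hφ0 : ∀ u, 0 ≤ φ u) : bodyVol f * bodyVol g ≤ bodyVol φ ^ 2 := by
  have hf0 := hfp.pos hn hf hfe
  have hg0 := hgp.pos hn hg hge
  have h1 := hLBM (bodyOf f) (bodyOf g) (isConvexBody_bodyOf hf.continuous hf0)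
    (isSymmetricSet_bodyOf hfe) (isConvexBody_bodyOf hg.continuous hg0)
    (isSymmetricSet_bodyOf hge) (1 / 2) ⟨by norm_num, by norm_num⟩
  rw [geomAverage, hfp.supportFn_bodyOf hn hf, hgp.supportFn_bodyOf hn hg] at h1
  have h2 : (fun u => f u ^ (1 / 2 : ℝ) * g u ^ (1 - 1 / 2 : ℝ)) ≤ φ := by
    intro u
    norm_num
    rw [← Real.sqrt_eq_rpow, ← Real.sqrt_eq_rpow, ← Real.sqrt_mul (hf0 u).le]
    exact Real.sqrt_le_iff.mpr ⟨hφ0 u, hle u⟩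
  have h3 := h1.trans (measure_mono (bodyOf_mono h2))
  have h4 := ENNReal.toReal_mono (volume_bodyOf_lt_top hφ).ne h3
  rw [ENNReal.toReal_mul, ← ENNReal.toReal_rpow, ← ENNReal.toReal_rpow] at h4
  norm_num at h4
  rw [← Real.sqrt_eq_rpow, ← Real.sqrt_eq_rpow] at h4
  have h5 := pow_le_pow_left₀ (by positivity) h4 2
  rwa [mul_pow, Real.sq_sqrt ENNReal.toReal_nonneg, Real.sq_sqrt ENNReal.toReal_nonneg] at h5

/-- The log-Brunn-Minkowski inequality for `h ± s ψ`, to second order in `s`. -/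
lemma LogBrunnMinkowski.second_variation (hLBM : LogBrunnMinkowski n) (hn : 2 ≤ n)
    (hh : IsC2 h) (he : IsEvenFn h) (hp : HasPosCurv h) (hψ : IsC2 ψ) (hψe : IsEvenFn ψ)
    (hψ0 : ∀ u, 0 < ψ u) :
    bodyVol h * (∫ u, ψ u ^ 2 / h u * curvDet h u ∂(sphereMeasure n) +
      ∫ u, ψ u * mixDet h ψ u ∂(sphereMeasure n)) ≤
        (∫ u, ψ u * curvDet h u ∂(sphereMeasure n)) ^ 2 := by
  have h0 := hp.pos hn hh he
  -- With `g = ψ² / (2h)` one has `(h - s² g)² = h² - s²ψ² + s⁴g²`, so `h - s² g` dominates the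
  -- geometric mean of `h ± sψ` and agrees with it to second order in `s`.
  set g : USphere n → ℝ := (1 / 2 : ℝ) • (ψ * ψ * h⁻¹) with hg
  have hg2 : IsC2 g := by
    -- The constant `1` is added and then subtracted so that `g` takes the form `f + t • g` to which
    -- `IsC2.add_smul` applies.
    have := IsC2.one.add_smul ((hψ.mul hψ).mul (hh.inv fun u => (h0 u).ne')) (1 / 2)
    have h1 := this.add_smul IsC2.one (-1)
    convert h1 using 1
    rw [hg]
    module
  have hgu : ∀ u, g u = ψ u ^ 2 / (2 * h u) := fun u => by
    have := (h0 u).ne'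
    simp only [hg, Pi.smul_apply, Pi.mul_apply, Pi.inv_apply, smul_eq_mul]
    field_simp
  have hg0 : ∀ u, 0 < g u := fun u => by
    rw [hgu]
    have := hψ0 u
    have := h0 u
    positivity
  set N : ℝ → ℝ := fun t => bodyVol (h + t • g)
  set ν : ℝ → ℝ := fun t => ∫ u, g u * curvDet (h + t • g) u ∂(sphereMeasure n)
  set G : ℝ → ℝ := fun t => bodyVol (h + t • ψ)
  set P : ℝ → ℝ := fun t => ∫ u, ψ u * curvDet (h + t • ψ) u ∂(sphereMeasure n)
  have hNν : ∀ᶠ t in 𝓝 (0 : ℝ), HasDerivAt N (ν t) t :=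
    (hp.eventually_add_smul hh hg2).mono fun t ht => ht.hasDerivAt_bodyVol hn hh hg2 hg0
  have hGP : ∀ᶠ t in 𝓝 (0 : ℝ), HasDerivAt G (P t) t :=
    (hp.eventually_add_smul hh hψ).mono fun t ht => ht.hasDerivAt_bodyVol hn hh hψ hψ0
  have hν := hasDerivAt_integral_mul_curvDet hh hg2 hg2 0
  have hP := hasDerivAt_integral_mul_curvDet hh hψ hψ 0
  change HasDerivAt ν _ 0 at hν
  change HasDerivAt P _ 0 at hP
  have hz : ∀ ρ : USphere n → ℝ, h + (0 : ℝ) • ρ = h := fun ρ => by rw [zero_smul, add_zero]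
  rw [hz] at hν hP
  have hneg : Tendsto (fun s : ℝ => -s) (𝓝 0) (𝓝 0) := by
    simpa using (continuous_neg (G := ℝ)).tendsto 0
  have hnsq : Tendsto (fun s : ℝ => -s ^ 2) (𝓝 0) (𝓝 0) := by
    have : Continuous fun s : ℝ => -s ^ 2 := by fun_prop
    simpa using this.tendsto 0
  have hdneg : ∀ s : ℝ, HasDerivAt (fun s : ℝ => -s) (-1) s := fun s => hasDerivAt_neg s
  have hdsq : ∀ s : ℝ, HasDerivAt (fun s : ℝ => -s ^ 2) (-(2 * s)) s := fun s =>
    (hasDerivAt_pow 2 s).neg.congr_deriv (by simp)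
  -- Near `0` the conjecture says `k ≥ 0 = k 0`. In `k'` the factor `s` from the inner derivative of
  -- `-s²` is kept outside, so only the value of `N ν` at `0`, and no derivative of it, survives in
  -- `k''(0)`.
  set k : ℝ → ℝ := fun s => N (-s ^ 2) ^ 2 - G s * G (-s)
  set k' : ℝ → ℝ := fun s => s * (-4 * (N (-s ^ 2) * ν (-s ^ 2))) - (P s * G (-s) - G s * P (-s))
  have hk : ∀ᶠ s in 𝓝 (0 : ℝ), HasDerivAt k (k' s) s := by
    filter_upwards [hnsq.eventually hNν, hGP, hneg.eventually hGP] with s h1 h2 h3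
    have h4 := ((h1.comp s (hdsq s)).pow 2).sub (h2.mul (h3.comp s (hdneg s)))
    refine h4.congr_deriv ?_
    simp only [k', Function.comp_apply]
    push_cast
    ring
  have hk2 : HasDerivAt k' (-4 * (N 0 * ν 0) -
      2 * ((∫ u, ψ u * mixDet h ψ u ∂(sphereMeasure n)) * G 0 - P 0 ^ 2)) 0 := by
    have e0 : -(0 : ℝ) ^ 2 = 0 := by norm_num
    have e1 : -(0 : ℝ) = 0 := by norm_num
    have hN0 := hNν.self_of_nhds
    have hG0 := hGP.self_of_nhds
    have a1 : HasDerivAt (fun s : ℝ => N (-s ^ 2)) _ 0 :=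
      HasDerivAt.comp (0 : ℝ) (h₂ := N) (by rw [e0]; exact hN0) (hdsq 0)
    have a2 : HasDerivAt (fun s : ℝ => ν (-s ^ 2)) _ 0 :=
      HasDerivAt.comp (0 : ℝ) (h₂ := ν) (by rw [e0]; exact hν) (hdsq 0)
    have a3 : HasDerivAt (fun s : ℝ => G (-s)) _ 0 :=
      HasDerivAt.comp (0 : ℝ) (h₂ := G) (by rw [e1]; exact hG0) (hdneg 0)
    have a4 : HasDerivAt (fun s : ℝ => P (-s)) _ 0 :=
      HasDerivAt.comp (0 : ℝ) (h₂ := P) (by rw [e1]; exact hP) (hdneg 0)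
    have a5 := ((hasDerivAt_id (0 : ℝ)).mul ((a1.mul a2).const_mul (-4))).sub
      ((hP.mul a3).sub (hG0.mul a4))
    refine a5.congr_deriv ?_
    simp only [id, e0, e1, Pi.mul_apply]
    ring
  have hNG : N 0 = bodyVol h ∧ G 0 = bodyVol h := by
    simp only [N, G, hz, and_self]
  have hmin : IsLocalMin k 0 := by
    have hk0 : k 0 = 0 := by
      simp only [k]
      norm_num
      rw [hNG.1, hNG.2]
      ring
    have hbd : ∀ᶠ s in 𝓝 (0 : ℝ), ∀ u : USphere n, 0 ≤ (h + (-s ^ 2) • g) u := by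
      filter_upwards [hnsq.eventually (hp.eventually_add_smul hh hg2)] with s hs u
      refine (hs.pos hn (hh.add_smul hg2 _) (he.add_smul ?_ _) u).le
      intro v
      rw [hgu, hgu, he v, hψe v]
    filter_upwards [hp.eventually_add_smul hh hψ,
      hneg.eventually (hp.eventually_add_smul hh hψ), hbd] with s h1 h2 h3
    rw [hk0]
    have h4 := hLBM.bodyVol_mul_le hn (hh.add_smul hψ s) (he.add_smul hψe s) h1
      (hh.add_smul hψ (-s)) (he.add_smul hψe (-s)) h2 (hh.add_smul hg2 (-s ^ 2)).continuous
      (fun u => ?_) h3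
    · simp only [k, N, G]
      linarith
    · simp only [Pi.add_apply, Pi.smul_apply, smul_eq_mul]
      have h5 : ψ u ^ 2 = 2 * h u * g u := by
        have := (h0 u).ne'
        rw [hgu]
        field_simp
      nlinarith [sq_nonneg (s ^ 2 * g u)]
  have hfin := second_deriv_nonneg_of_isLocalMin hmin hk hk2
  have hν0 : ν 0 = (1 / 2) * ∫ u, ψ u ^ 2 / h u * curvDet h u ∂(sphereMeasure n) := by
    simp only [ν, hz]
    rw [← integral_const_mul]
    refine integral_congr_ae (Eventually.of_forall fun u => ?_)
    have := (h0 u).ne'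
    simp only [hgu]
    field_simp
  have hP0 : P 0 = ∫ u, ψ u * curvDet h u ∂(sphereMeasure n) := by simp only [P, hz]
  rw [hν0, hP0, hNG.1, hNG.2] at hfin
  linarith

end

/-! ### Integrals against the cone measure and the conclusion -/

noncomputable section

open Filter Topology

variable {n : ℕ} [NeZero n] {e : SphereFrame n} {h ψ : USphere n → ℝ}

namespace IsC2PlusEven

lemma hasPosCurv (hh : IsC2PlusEven e h) : HasPosCurv h :=
  hasPosCurv_of_posDef hh.isC2 e hh.curvMatrix_posDef

lemma pos (hh : IsC2PlusEven e h) (hn : 2 ≤ n) (u : USphere n) : 0 < h u :=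
  hh.hasPosCurv.pos hn hh.isC2 hh.even u

lemma bodyVol_pos (hh : IsC2PlusEven e h) (hn : 2 ≤ n) : 0 < bodyVol h := by
  have h1 := interior_bodyOf_nonempty hh.isC2.continuous (hh.pos hn)
  exact ENNReal.toReal_pos
    ((isOpen_interior.measure_pos volume h1).trans_le (measure_mono interior_subset)).ne'
    (volume_bodyOf_lt_top hh.isC2.continuous).ne

/-- The integrand `l` is left free up to a pointwise identity, so that each use can supply the form
in which the density factor `h` has cancelled the denominators of `k`. -/
lemma integral_coneMeasure (hh : IsC2PlusEven e h) (hn : 2 ≤ n) {k l : USphere n → ℝ}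
    (hkl : ∀ u, l u = h u * curvDet h u * k u) :
    ∫ u, k u ∂(coneMeasure e h) = 1 / (n * bodyVol h) * ∫ u, l u ∂(sphereMeasure n) := by
  have hdet : ∀ u, (curvMatrix e h u).det = curvDet h u := fun u =>
    (curvDet_eq_det_curvMatrix hh.isC2 e u).symm
  have hmeas : Measurable fun u : USphere n =>
      ENNReal.ofReal (1 / volume.real (bodyOf h) * (1 / n) * h u * curvDet h u) := by
    have h1 := hh.isC2.continuous
    have h2 := continuous_curvDet hh.isC2
    exact (Continuous.measurable (by fun_prop)).ennreal_ofReal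
  rw [coneMeasure]
  simp only [hdet]
  rw [integral_withDensity_eq_integral_toReal_smul hmeas
    (Eventually.of_forall fun u => ENNReal.ofReal_lt_top), ← integral_const_mul]
  refine integral_congr_ae (Eventually.of_forall fun u => ?_)
  have hV := hh.bodyVol_pos hn
  have h3 := hh.pos hn u
  have h4 := hh.hasPosCurv.curvDet_pos hh.isC2 u
  have h5 : volume.real (bodyOf h) = bodyVol h := rfl
  have hn0 : (0 : ℝ) < n := by positivity
  simp only [h5, hkl]
  rw [ENNReal.toReal_ofReal (by positivity), smul_eq_mul]
  field_simp

lemma continuous_sq_div (hh : IsC2PlusEven e h) (hn : 2 ≤ n) (hψ : IsC2 ψ) :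
    Continuous fun u => ψ u ^ 2 / h u * curvDet h u :=
  ((hψ.continuous.pow 2).div hh.isC2.continuous fun u => (hh.pos hn u).ne').mul
    (continuous_curvDet hh.isC2)

lemma integral_sq_mul (hh : IsC2PlusEven e h) (hn : 2 ≤ n) :
    ∫ u, ψ u ^ 2 * ((curvMatrix e h u)⁻¹.trace / h u) ∂(coneMeasure e h) =
      1 / (n * bodyVol h) * ∫ u, ψ u ^ 2 * mixDet h 1 u ∂(sphereMeasure n) := by
  refine hh.integral_coneMeasure hn fun u => ?_
  have := (hh.pos hn u).ne'
  rw [mixDet_one hh.isC2 e u (hh.curvMatrix_posDef u), curvDet_eq_det_curvMatrix hh.isC2 e u]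
  field_simp

lemma integral_sq_mul_add (hh : IsC2PlusEven e h) (hn : 2 ≤ n) (hψ : IsC2 ψ) :
    ∫ u, ψ u ^ 2 * ((1 + (curvMatrix e h u)⁻¹.trace * h u) / h u ^ 2) ∂(coneMeasure e h) =
      1 / (n * bodyVol h) * ∫ u, ψ u ^ 2 / h u * curvDet h u ∂(sphereMeasure n) +
        1 / (n * bodyVol h) * ∫ u, ψ u ^ 2 * mixDet h 1 u ∂(sphereMeasure n) := by
  have c1 : Integrable (fun u => ψ u ^ 2 * mixDet h 1 u) (sphereMeasure n) :=
    integrable_sphere ((hψ.continuous.pow 2).mul (continuous_mixDet hh.isC2 IsC2.one))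
  rw [← mul_add, ← integral_add (integrable_sphere (hh.continuous_sq_div hn hψ)) c1]
  refine hh.integral_coneMeasure hn fun u => ?_
  have := (hh.pos hn u).ne'
  rw [mixDet_one hh.isC2 e u (hh.curvMatrix_posDef u), curvDet_eq_det_curvMatrix hh.isC2 e u]
  field_simp

lemma integral_div (hh : IsC2PlusEven e h) (hn : 2 ≤ n) :
    ∫ u, ψ u / h u ∂(coneMeasure e h) =
      1 / (n * bodyVol h) * ∫ u, ψ u * curvDet h u ∂(sphereMeasure n) := by
  refine hh.integral_coneMeasure hn fun u => ?_
  have := (hh.pos hn u).ne'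
  field_simp

/-- Integration by parts for the quadratic form of the inverse curvature matrix. -/
lemma integral_dirichlet (hh : IsC2PlusEven e h) (hn : 2 ≤ n) (hψ : IsC2 ψ)
    (hψ0 : ∀ u, 0 < ψ u) :
    ∫ u, 1 / h u * (((curvMatrix e h u)⁻¹.mulVec (sphGrad e ψ u)) ⬝ᵥ sphGrad e ψ u)
        ∂(coneMeasure e h) =
      1 / (n * bodyVol h) * (∫ u, ψ u ^ 2 * mixDet h 1 u ∂(sphereMeasure n) -
        ∫ u, ψ u * mixDet h ψ u ∂(sphereMeasure n)) := by
  have c1 : Integrable (fun u => 1 / 2 * (ψ u ^ 2 * mixDet h 1 u)) (sphereMeasure n) :=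
    (integrable_sphere ((hψ.continuous.pow 2).mul
      (continuous_mixDet hh.isC2 IsC2.one))).const_mul _
  have c2 : Integrable (fun u => ψ u * mixDet h ψ u) (sphereMeasure n) :=
    integrable_sphere (hψ.continuous.mul (continuous_mixDet hh.isC2 hψ))
  have c3 := integrable_sphere (continuous_mixDet hh.isC2 (hψ.mul hψ))
  -- Self-adjointness for the pair `1`, `ψ²` gives `∫ mixDet h (ψ²) = ∫ ψ² mixDet h 1`. Half of `∫
  -- ψ² mixDet h 1` is traded for half of `∫ mixDet h (ψ²)`, and the integrand becomes pointwise the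
  -- gradient form of `mixDet_mul_self`.
  have hsymm := integral_mul_mixDet_comm hn hh.isC2 hh.hasPosCurv IsC2.one (hψ.mul hψ)
    (fun u => one_pos) (fun u => mul_pos (hψ0 u) (hψ0 u))
  have hsq : ∀ u, (ψ * ψ) u = ψ u ^ 2 := fun u => by simp [sq]
  simp only [Pi.one_apply, one_mul, hsq] at hsymm
  have hsplit : ∫ u, ψ u ^ 2 * mixDet h 1 u ∂(sphereMeasure n) -
      ∫ u, ψ u * mixDet h ψ u ∂(sphereMeasure n) =
      ∫ u, (1 / 2 * mixDet h (ψ * ψ) u - ψ u * mixDet h ψ u + 1 / 2 * (ψ u ^ 2 * mixDet h 1 u))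
        ∂(sphereMeasure n) := by
    have c4 : Integrable (fun u => 1 / 2 * mixDet h (ψ * ψ) u - ψ u * mixDet h ψ u)
        (sphereMeasure n) := (c3.const_mul _).sub c2
    rw [integral_add c4 c1, integral_sub (c3.const_mul _) c2,
      integral_const_mul, integral_const_mul, hsymm]
    ring
  rw [hsplit]
  refine hh.integral_coneMeasure hn fun u => ?_
  have := (hh.pos hn u).ne'
  rw [mixDet_mul_self hh.isC2 hψ e u (hh.curvMatrix_posDef u), curvDet_eq_det_curvMatrix hh.isC2 e u]
  field_simp
  ring

/-- The Cauchy-Schwarz inequality for the normalized cone measure. -/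
lemma sq_integral_coneMeasure_le (hh : IsC2PlusEven e h) (hn : 2 ≤ n) (hψ : IsC2 ψ) :
    (∫ u, ψ u / h u ∂(coneMeasure e h)) ^ 2 ≤
      1 / (n * bodyVol h) * ∫ u, ψ u ^ 2 / h u * curvDet h u ∂(sphereMeasure n) := by
  set c : ℝ := 1 / (n * bodyVol h) with hc
  set m : ℝ := ∫ u, ψ u / h u ∂(coneMeasure e h)
  have hV := hh.bodyVol_pos hn
  have hn0 : (0 : ℝ) < n := by positivity
  have hm : m = c * ∫ u, ψ u * curvDet h u ∂(sphereMeasure n) := hh.integral_div hn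
  -- The cone measure has total mass one, by the volume formula.
  have hmass : c * ∫ u, h u * curvDet h u ∂(sphereMeasure n) = 1 := by
    have h1 := bodyVol_eq hn hh.isC2 (hh.pos hn) hh.hasPosCurv
    have h2 : ∫ u, h u * curvDet h u ∂(sphereMeasure n) = n * bodyVol h := by
      rw [h1]; field_simp
    rw [h2, hc]
    field_simp
  have c1 := integrable_sphere (hh.continuous_sq_div hn hψ)
  have c2 : Integrable (fun u => 2 * m * (ψ u * curvDet h u)) (sphereMeasure n) :=
    (integrable_sphere (hψ.continuous.mul (continuous_curvDet hh.isC2))).const_mul _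
  have c3 : Integrable (fun u => m ^ 2 * (h u * curvDet h u)) (sphereMeasure n) :=
    (integrable_sphere (hh.isC2.continuous.mul (continuous_curvDet hh.isC2))).const_mul _
  have c4 : Integrable (fun u => ψ u ^ 2 / h u * curvDet h u - 2 * m * (ψ u * curvDet h u))
      (sphereMeasure n) := c1.sub c2
  -- Up to the factor `c`, this is the variance of `ψ / h` under the cone measure, with mean `m`.
  have h1 : 0 ≤ ∫ u, (ψ u ^ 2 / h u * curvDet h u - 2 * m * (ψ u * curvDet h u) +
      m ^ 2 * (h u * curvDet h u)) ∂(sphereMeasure n) := by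
    refine integral_nonneg fun u => ?_
    have h2 := hh.pos hn u
    have h3 := hh.hasPosCurv.curvDet_pos hh.isC2 u
    have h4 : ψ u ^ 2 / h u * curvDet h u - 2 * m * (ψ u * curvDet h u) +
        m ^ 2 * (h u * curvDet h u) = curvDet h u / h u * (ψ u - m * h u) ^ 2 := by
      field_simp
      ring
    simp only [h4]
    positivity
  rw [integral_add c4 c3, integral_sub c1 c2,
    integral_const_mul, integral_const_mul] at h1
  have hc0 : 0 ≤ c := by positivity
  have h5 := mul_nonneg hc0 h1
  linear_combination h5 + m ^ 2 * hmass + 2 * m * hm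

/-- The infinitesimal form of the log-Brunn-Minkowski inequality. -/
lemma infinitesimal_log_brunnMinkowski (hh : IsC2PlusEven e h) (hn : 2 ≤ n)
    (hLBM : LogBrunnMinkowski n) (hψ : IsC2 ψ) (hψe : IsEvenFn ψ) (hψ0 : ∀ u, 0 < ψ u) :
    (∫ u, ψ u ^ 2 * ((1 + (curvMatrix e h u)⁻¹.trace * h u) / h u ^ 2) ∂(coneMeasure e h))
        - n * (∫ u, ψ u / h u ∂(coneMeasure e h)) ^ 2
      ≤ ∫ u, 1 / h u * (((curvMatrix e h u)⁻¹.mulVec (sphGrad e ψ u)) ⬝ᵥ sphGrad e ψ u)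
          ∂(coneMeasure e h) := by
  rw [hh.integral_sq_mul_add hn hψ, hh.integral_div hn, hh.integral_dirichlet hn hψ hψ0]
  have h1 := hLBM.second_variation hn hh.isC2 hh.even hh.hasPosCurv hψ hψe hψ0
  have hV := hh.bodyVol_pos hn
  have hn0 : (0 : ℝ) < n := by positivity
  set A := ∫ u, ψ u ^ 2 / h u * curvDet h u ∂(sphereMeasure n)
  set B := ∫ u, ψ u ^ 2 * mixDet h 1 u ∂(sphereMeasure n)
  set R := ∫ u, ψ u * mixDet h ψ u ∂(sphereMeasure n)
  set S := ∫ u, ψ u * curvDet h u ∂(sphereMeasure n)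
  have h2 : A + R ≤ S ^ 2 / bodyVol h := by
    rw [le_div_iff₀ hV]; linarith
  have h3 : n * (1 / (n * bodyVol h) * S) ^ 2 = 1 / (n * bodyVol h) * (S ^ 2 / bodyVol h) := by
    field_simp
  rw [h3]
  have h4 := mul_le_mul_of_nonneg_left h2 (show 0 ≤ 1 / (n * bodyVol h) by positivity)
  linarith

end IsC2PlusEven

end

theorem theorem6p5 (n : ℕ) [n.AtLeastTwo] (e : SphereFrame n) :
    -- the log-Brunn-Minkowski conjecture implies its infinitesimal form
    (LogBrunnMinkowski n →
      ∀ h : USphere n → ℝ, IsC2PlusEven e h →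
      ∀ ψ : USphere n → ℝ, IsC2 ψ → IsEvenFn ψ → (∀ u, 0 < ψ u) →
        (∫ u, ψ u ^ 2 * ((1 + (curvMatrix e h u)⁻¹.trace * h u) / h u ^ 2) ∂(coneMeasure e h))
            - n * (∫ u, ψ u / h u ∂(coneMeasure e h)) ^ 2
          ≤ ∫ u, 1 / h u * (((curvMatrix e h u)⁻¹.mulVec (sphGrad e ψ u)) ⬝ᵥ sphGrad e ψ u)
              ∂(coneMeasure e h)) ∧
    -- `bodyOf h` is the convex body with support function `h`
    (∀ h : USphere n → ℝ, IsC2PlusEven e h →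
      IsConvexBody (bodyOf h) ∧ supportFn (bodyOf h) = h) ∧
    -- the left-hand side above dominates the one of the infinitesimal Brunn-Minkowski inequality,
    -- whose right-hand side is the same
    (∀ h : USphere n → ℝ, IsC2PlusEven e h →
      ∀ ψ : USphere n → ℝ, IsC2 ψ → IsEvenFn ψ → (∀ u, 0 < ψ u) →
        (∫ u, ψ u ^ 2 * ((curvMatrix e h u)⁻¹.trace / h u) ∂(coneMeasure e h))
            - (n - 1) * (∫ u, ψ u / h u ∂(coneMeasure e h)) ^ 2
          ≤ (∫ u, ψ u ^ 2 * ((1 + (curvMatrix e h u)⁻¹.trace * h u) / h u ^ 2)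
                ∂(coneMeasure e h))
            - n * (∫ u, ψ u / h u ∂(coneMeasure e h)) ^ 2) := by
  have hn : 2 ≤ n := Nat.AtLeastTwo.prop
  refine ⟨fun hLBM h hh ψ hψ hψe hψ0 => ?_, fun h hh => ?_, fun h hh ψ hψ hψe hψ0 => ?_⟩
  · exact hh.infinitesimal_log_brunnMinkowski hn hLBM hψ hψe hψ0
  · have hp := hh.hasPosCurv
    exact ⟨isConvexBody_bodyOf hh.isC2.continuous (hp.pos hn hh.isC2 hh.even),
      hp.supportFn_bodyOf hn hh.isC2⟩
  -- The trace terms cancel, and the two left-hand sides differ by the second moment of `ψ / h`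
  -- minus its squared mean.
  · rw [hh.integral_sq_mul_add hn hψ, hh.integral_sq_mul hn]
    have := hh.sq_integral_coneMeasure_le hn hψ
    linarith
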